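/- Fix $N\ge 2$ qubits and let $\mathrm{Haar}$ denote the Haar probability measure on the unitary group of $(\mathbb C^2)^{\otimes N}$. A random circuit architecture is a finite sequence of subsets of the $N$ sites; it defines a random unitary, the product (first gate applied first) of independent Haar-random unitary gates, one on each of these subsets, tensored with the identity on the other sites. Let $C$ be the architecture with five gates, acting in this order on: all sites except the first; the first and second sites; all sites except the second; the first and second sites; all sites except the first. Let $C'$ be obtained from $C$ by deleting the two gates on the first and second sites. For an architecture $A$, let $A^d$ be $A$ repeated $d$ times in sequence (all gates independent). For the law $\nu$ of a random unitary, let $\Phi_\nu(\rho)=\mathbb E_{U\sim\nu}\big[U^{\otimes 2}\rho\,(U^{\otimes 2})^\dagger\big]$ be its second moment operator, and let $\Phi_{\mathrm{Haar}}$ be the one of the Haar measure. Call $\nu$ an additive-error $\epsilon$-approximate $2$-design if $\|\Phi_\nu-\Phi_{\mathrm{Haar}}\|_\diamond\le\epsilon$ (diamond norm), and a multiplicative-error $\epsilon$-approximate $2$-design if both maps $\epsilon\,\Phi_{\mathrm{Haar}}\pm(\Phi_\nu-\Phi_{\mathrm{Haar}})$ are completely positive. **Theorem.** For all sufficiently large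 $N$ the following holds for each of the two notions, additive error and multiplicative error: there exist $\epsilon>0$ and $d\in\mathbb N$ such that $C'^d$ is an $\epsilon$-approximate $2$-design (in the sense of that notion) and $C^d$ is not. -/

import Mathlib

open MeasureTheory Matrix
open scoped Kronecker ENNReal ComplexOrder

namespace RandomCircuit

section UnitaryGroup

variable {n : Type} [Fintype n] [DecidableEq n]

/-- The unitary group carries its Borel σ-algebra. -/
noncomputable instance instMeasurableSpaceUnitary : MeasurableSpace (unitaryGroup n ℂ) := borel _

instance instBorelSpaceUnitary : BorelSpace (unitaryGroup n ℂ) := ⟨rfl⟩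

instance instSecondCountableUnitary : SecondCountableTopology (unitaryGroup n ℂ) :=
  haveI : SecondCountableTopology (Matrix n n ℂ) :=
    inferInstanceAs (SecondCountableTopology (n → n → ℂ))
  inferInstanceAs (SecondCountableTopology ((unitaryGroup n ℂ : Set (Matrix n n ℂ))))

instance instCompactSpaceUnitary : CompactSpace (unitaryGroup n ℂ) := by
  refine isCompact_iff_compactSpace.mp (?_ : IsCompact (unitaryGroup n ℂ : Set (Matrix n n ℂ)))
  have hK : IsCompact (Set.univ.pi fun _ : n => Set.univ.pi fun _ : n =>
      Metric.closedBall (0 : ℂ) 1) :=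
    isCompact_univ_pi fun _ => isCompact_univ_pi fun _ => isCompact_closedBall _ _
  have hc : IsClosed (unitaryGroup n ℂ : Set (Matrix n n ℂ)) := by
    have h : (unitaryGroup n ℂ : Set (Matrix n n ℂ)) = {A | A * star A = 1} := by
      ext A
      exact mem_unitaryGroup_iff
    rw [h]
    exact isClosed_eq (continuous_id.mul continuous_star) continuous_const
  refine hK.of_isClosed_subset hc ?_
  intro A hA i _ j _
  simpa using entry_norm_bound_of_unitary hA i j

/-- The normalised Haar measure on the unitary group: the unique translation-invariant
probability measure. -/
noncomputable def haarUnitary (n : Type) [Fintype n] [DecidableEq n] :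
    Measure (unitaryGroup n ℂ) :=
  Measure.haarMeasure ⊤

instance instIsProbabilityMeasureHaar : IsProbabilityMeasure (haarUnitary n) :=
  ⟨by
    have h := Measure.haarMeasure_self (G := unitaryGroup n ℂ) (K₀ := ⊤)
    simpa [haarUnitary] using h⟩

end UnitaryGroup

section Moments

variable {n : Type} [Fintype n] [DecidableEq n]

/-- The tensor power `U^{⊗ t}`, a matrix acting on `(ℂⁿ)^{⊗ t}`. -/
def tensorPow (t : ℕ) (U : Matrix n n ℂ) : Matrix (Fin t → n) (Fin t → n) ℂ :=
  Matrix.of fun x y => ∏ k, U (x k) (y k)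

theorem integrable_twirl (t : ℕ) (ν : Measure (unitaryGroup n ℂ)) [IsProbabilityMeasure ν]
    (ρ : Matrix (Fin t → n) (Fin t → n) ℂ) (x y : Fin t → n) :
    Integrable (fun U : unitaryGroup n ℂ =>
      (tensorPow t U.1 * ρ * (tensorPow t U.1)ᴴ) x y) ν := by
  have hT : Continuous fun U : unitaryGroup n ℂ => tensorPow t U.1 := by
    refine continuous_matrix fun a b => ?_
    have hv : Continuous fun U : unitaryGroup n ℂ => U.1 := continuous_subtype_val
    simp only [tensorPow, Matrix.of_apply]
    exact continuous_finsetProd _ fun k _ => hv.matrix_elem (a k) (b k)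
  have hc : Continuous fun U : unitaryGroup n ℂ =>
      (tensorPow t U.1 * ρ * (tensorPow t U.1)ᴴ) x y :=
    ((hT.matrix_mul continuous_const).matrix_mul hT.matrix_conjTranspose).matrix_elem x y
  exact hc.integrable_of_hasCompactSupport (HasCompactSupport.of_compactSpace _)

/-- The `t`-th moment operator of a random unitary `U` with law `ν`:
`ρ ↦ 𝔼_U [U^{⊗ t} ρ (U^{⊗ t})†]`. -/
noncomputable def momentOp (t : ℕ) (ν : Measure (unitaryGroup n ℂ)) [IsProbabilityMeasure ν] :
    Matrix (Fin t → n) (Fin t → n) ℂ →ₗ[ℂ] Matrix (Fin t → n) (Fin t → n) ℂ where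
  toFun ρ := Matrix.of fun x y => ∫ U, (tensorPow t U.1 * ρ * (tensorPow t U.1)ᴴ) x y ∂ν
  map_add' ρ σ := by
    ext x y
    simp only [Matrix.mul_add, Matrix.add_mul, Matrix.add_apply, Matrix.of_apply]
    exact integral_add (integrable_twirl t ν ρ x y) (integrable_twirl t ν σ x y)
  map_smul' c ρ := by
    ext x y
    simp only [RingHom.id_apply, Matrix.mul_smul, Matrix.smul_mul, Matrix.smul_apply,
      Matrix.of_apply]
    exact integral_smul c _

end Moments

section Superoperators

variable {m : Type} [Fintype m] [DecidableEq m]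

/-- `Φ ⊗ id`, where the identity acts on `k × k` matrices. -/
def ampliate (k : ℕ) (Φ : Matrix m m ℂ →ₗ[ℂ] Matrix m m ℂ)
    (X : Matrix (m × Fin k) (m × Fin k) ℂ) : Matrix (m × Fin k) (m × Fin k) ℂ :=
  Matrix.of fun a b => Φ (Matrix.of fun i j => X (i, a.2) (j, b.2)) a.1 b.1

/-- The trace norm `‖X‖₁`: the sum of the singular values of `X`. -/
noncomputable def traceNorm {l : Type} [Fintype l] [DecidableEq l] (X : Matrix l l ℂ) : ℝ :=
  ∑ i, √((isHermitian_conjTranspose_mul_self X).eigenvalues i)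

/-- The diamond norm: the supremum over all ancilla dimensions `k` of the norm of `Φ ⊗ id`
induced by the trace norm. -/
noncomputable def diamondNorm (Φ : Matrix m m ℂ →ₗ[ℂ] Matrix m m ℂ) : ℝ≥0∞ :=
  ⨆ (k : ℕ) (X : Matrix (m × Fin k) (m × Fin k) ℂ) (_ : traceNorm X ≤ 1),
    ENNReal.ofReal (traceNorm (ampliate k Φ X))

/-- Complete positivity: `Φ ⊗ id` preserves positive semidefiniteness for every ancilla. -/
def IsCompletelyPositive (Φ : Matrix m m ℂ →ₗ[ℂ] Matrix m m ℂ) : Prop :=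
  ∀ (k : ℕ) (X : Matrix (m × Fin k) (m × Fin k) ℂ), X.PosSemidef → (ampliate k Φ X).PosSemidef

end Superoperators

section Designs

variable {n : Type} [Fintype n] [DecidableEq n]

/-- `ν` is an additive-error `ε`-approximate `t`-design: its `t`-th moment operator is within
diamond-norm distance `ε` of that of the Haar measure. -/
def IsAdditiveApproxDesign (t : ℕ) (ε : ℝ) (ν : Measure (unitaryGroup n ℂ))
    [IsProbabilityMeasure ν] : Prop :=
  diamondNorm (momentOp t ν - momentOp t (haarUnitary n)) ≤ ENNReal.ofReal ε

/-- `ν` is a multiplicative-error `ε`-approximate `t`-design: `ε Φ_Haar ± (Φ_ν - Φ_Haar)` are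
completely positive, i.e. `(1 - ε) Φ_Haar ≼ Φ_ν ≼ (1 + ε) Φ_Haar` in the completely positive
order. -/
def IsMultiplicativeApproxDesign (t : ℕ) (ε : ℝ) (ν : Measure (unitaryGroup n ℂ))
    [IsProbabilityMeasure ν] : Prop :=
  IsCompletelyPositive ((ε : ℂ) • momentOp t (haarUnitary n) +
      (momentOp t ν - momentOp t (haarUnitary n))) ∧
    IsCompletelyPositive ((ε : ℂ) • momentOp t (haarUnitary n) -
      (momentOp t ν - momentOp t (haarUnitary n)))

end Designs

section Circuits

/-- The computational basis of `N` qubits. -/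
abbrev Qubits (N : ℕ) : Type := Fin N → Fin 2

/-- The computational basis of the qubits in `S`. -/
abbrev QubitsOn {N : ℕ} (S : Finset (Fin N)) : Type := {i : Fin N // i ∈ S} → Fin 2

/-- Splitting a basis state into its parts inside and outside `S`. -/
def splitQubits {N : ℕ} (S : Finset (Fin N)) :
    Qubits N ≃ QubitsOn S × ({i : Fin N // i ∉ S} → Fin 2) :=
  Equiv.piEquivPiSubtypeProd (fun i => i ∈ S) (fun _ => Fin 2)

/-- A gate on the qubits in `S`, as a unitary `U ⊗ 1` on all `N` qubits. -/
def embedGate {N : ℕ} (S : Finset (Fin N)) (U : unitaryGroup (QubitsOn S) ℂ) :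
    unitaryGroup (Qubits N) ℂ :=
  ⟨(U.1 ⊗ₖ (1 : Matrix ({i : Fin N // i ∉ S} → Fin 2) ({i : Fin N // i ∉ S} → Fin 2) ℂ)).submatrix
      (splitQubits S) (splitQubits S), by
    have h := kronecker_mem_unitary U.2 (one_mem (unitary (Matrix ({i : Fin N // i ∉ S} → Fin 2)
      ({i : Fin N // i ∉ S} → Fin 2) ℂ)))
    rw [mem_unitaryGroup_iff, star_eq_conjTranspose, conjTranspose_submatrix,
      submatrix_mul_equiv, ← star_eq_conjTranspose, Unitary.mul_star_self_of_mem h,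
      submatrix_one_equiv]⟩

theorem continuous_embedGate {N : ℕ} (S : Finset (Fin N)) : Continuous (embedGate S) := by
  refine Continuous.subtype_mk (continuous_matrix fun x y => ?_) _
  exact (continuous_subtype_val.matrix_elem _ _).mul continuous_const

/-- The law of a Haar-random gate on the qubits in `S`. -/
noncomputable def gateLaw {N : ℕ} (S : Finset (Fin N)) : Measure (unitaryGroup (Qubits N) ℂ) :=
  (haarUnitary (QubitsOn S)).map (embedGate S)

instance instIsProbabilityMeasureGateLaw {N : ℕ} (S : Finset (Fin N)) :
    IsProbabilityMeasure (gateLaw S) :=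
  Measure.isProbabilityMeasure_map (continuous_embedGate S).measurable.aemeasurable

/-- An architecture: the supports of the gates, in the order in which the gates are applied. -/
abbrev Architecture (N : ℕ) : Type := List (Finset (Fin N))

/-- The architecture obtained by repeating `A` in sequence `d` times. -/
def Architecture.repeated {N : ℕ} (A : Architecture N) (d : ℕ) : Architecture N :=
  (List.replicate d A).flatten

/-- The law of the unitary `U_k ⋯ U₂ U₁` implemented by a circuit with independent Haar-random
gates on the given supports, where the first gate of the list is applied first. -/
noncomputable def circuitLaw {N : ℕ} : Architecture N → Measure (unitaryGroup (Qubits N) ℂ)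
  | [] => Measure.dirac 1
  | S :: A => Measure.mconv (circuitLaw A) (gateLaw S)

instance instIsProbabilityMeasureCircuitLaw {N : ℕ} (A : Architecture N) :
    IsProbabilityMeasure (circuitLaw A) := by
  induction A with
  | nil => exact Measure.dirac.isProbabilityMeasure
  | cons S A ih =>
    have := ih
    exact Measure.isProbabilityMeasure_map measurable_mul.aemeasurable

/-- All sites except the first. -/
def exceptFirst (N : ℕ) : Finset (Fin N) := {i | i.val ≠ 0}

/-- The first and the second site. -/
def firstTwo (N : ℕ) : Finset (Fin N) := {i | i.val = 0 ∨ i.val = 1}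

/-- All sites except the second. -/
def exceptSecond (N : ℕ) : Finset (Fin N) := {i | i.val ≠ 1}

/-- The five-gate period `C`. -/
def periodC (N : ℕ) : Architecture N :=
  [exceptFirst N, firstTwo N, exceptSecond N, firstTwo N, exceptFirst N]

/-- The censored period `C'`: the two gates on the first two sites are deleted. -/
def periodC' (N : ℕ) : Architecture N :=
  [exceptFirst N, exceptSecond N, exceptFirst N]

end Circuits

end RandomCircuit

open RandomCircuit

set_option linter.unusedSectionVars false

namespace RandomCircuit


/-! ### Moment operators: multiplicativity and composition -/

section Moments

variable {n : Type} [Fintype n] [DecidableEq n]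

/-! Averaging two copies over a Haar gate on `S` leaves, on the sites of `S`, only combinations of
the identity and the exchange of the copies. Group the sites as first, second and the other M = N -
2; then gates act on label patterns `partSwap M a b c`, a label saying whether the copies of that
group are exchanged. The two constant patterns are fixed by every gate, and one period sends every
operator into the span of the patterns (a, c, c). Convergence is therefore governed by the weight r
with which a pattern (a, !a, !a) returns to itself after one period.

Since the Haar moment absorbs every moment operator (`momentOp_haar_momentOp`), the error after d +
1 periods is exactly r^d times the error after one (`momentOp_repeated_sub_haar`). In C' the pattern
returns only if a single site prevails twice against the block of M sites, so r' = `smallWeight`² is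
of order 4^(-M). In C the two-site gates can hand the first label to the second site, after which
the big gates side with the majority: the pattern returns with r = (2/5 · `largeWeight`)², which
tends to 1/25. Thus r' < r once M ≥ 3.

It remains to compare r'^d and r^d times two fixed maps. For the additive notion, the diamond norm
of the C' error is finite and that of the C error is positive. For the multiplicative notion, every
moment operator is dominated by a multiple of the Haar moment (`exists_dotProduct_ampliate_le`),
because sup norm and L² norm are comparable on the span of the entries of U^⊗t. Conversely, if the C
error plus arbitrarily small multiples of the Haar moment were completely positive, that error would
preserve positivity while annihilating traces, hence vanish. -/

theorem tensorPow_mul (t : ℕ) (U V : Matrix n n ℂ) :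
    tensorPow t (U * V) = tensorPow t U * tensorPow t V := by
  ext x y
  simp only [tensorPow, Matrix.mul_apply, Matrix.of_apply, Finset.prod_univ_sum,
    Fintype.piFinset_univ, Finset.prod_mul_distrib]

theorem tensorPow_one (t : ℕ) : tensorPow t (1 : Matrix n n ℂ) = 1 := by
  ext x y
  simp only [tensorPow, Matrix.of_apply, Matrix.one_apply, Finset.prod_ite_zero,
    Finset.prod_const_one, Finset.mem_univ, true_implies, funext_iff]

theorem tensorPow_conjTranspose (t : ℕ) (U : Matrix n n ℂ) :
    tensorPow t Uᴴ = (tensorPow t U)ᴴ := by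
  ext x y
  simp [tensorPow, Matrix.conjTranspose_apply]

theorem tensorPow_unitary (t : ℕ) (U : unitaryGroup n ℂ) :
    tensorPow t U.1 * (tensorPow t U.1)ᴴ = 1 := by
  rw [← tensorPow_conjTranspose, ← tensorPow_mul, ← star_eq_conjTranspose,
    mem_unitaryGroup_iff.mp U.2, tensorPow_one]

theorem tensorPow_unitary' (t : ℕ) (U : unitaryGroup n ℂ) :
    (tensorPow t U.1)ᴴ * tensorPow t U.1 = 1 := by
  rw [← tensorPow_conjTranspose, ← tensorPow_mul, ← star_eq_conjTranspose,
    mem_unitaryGroup_iff'.mp U.2, tensorPow_one]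

/-- Linear functionals commute with the integral that defines the moment operator. -/
theorem apply_momentOp (t : ℕ) (ν : Measure (unitaryGroup n ℂ)) [IsProbabilityMeasure ν]
    (L : Matrix (Fin t → n) (Fin t → n) ℂ →ₗ[ℂ] ℂ) (ρ : Matrix (Fin t → n) (Fin t → n) ℂ) :
    L (momentOp t ν ρ) = ∫ U, L (tensorPow t U.1 * ρ * (tensorPow t U.1)ᴴ) ∂ν := by
  have h : ∀ M, L M = ∑ x, ∑ y, M x y * L (single x y 1) := by
    intro M
    conv_lhs => rw [matrix_eq_sum_single M]
    simp only [map_sum]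
    refine Finset.sum_congr rfl fun x _ => Finset.sum_congr rfl fun y _ => ?_
    rw [← smul_eq_mul, ← map_smul, smul_single, smul_eq_mul, mul_one]
  have h' : (fun U : unitaryGroup n ℂ => L (tensorPow t U.1 * ρ * (tensorPow t U.1)ᴴ)) =
      fun U => ∑ x, ∑ y, (tensorPow t U.1 * ρ * (tensorPow t U.1)ᴴ) x y * L (single x y 1) :=
    funext fun U => h _
  rw [h, h', integral_finsetSum _ fun x _ => integrable_finsetSum _ fun y _ =>
    (integrable_twirl t ν ρ x y).mul_const _]
  refine Finset.sum_congr rfl fun x _ => ?_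
  rw [integral_finsetSum _ fun y _ => (integrable_twirl t ν ρ x y).mul_const _]
  refine Finset.sum_congr rfl fun y _ => ?_
  rw [integral_mul_const]
  rfl

/-- The entry `(x, y)` of `A * M * B` as a linear functional of `M`. -/
def sandwichEntry {m : Type} [Fintype m] (A B : Matrix m m ℂ) (x y : m) :
    Matrix m m ℂ →ₗ[ℂ] ℂ where
  toFun M := (A * M * B) x y
  map_add' M M' := by simp [Matrix.mul_add, Matrix.add_mul]
  map_smul' c M := by simp

theorem continuous_twirl (t : ℕ) (ρ : Matrix (Fin t → n) (Fin t → n) ℂ) (x y : Fin t → n) :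
    Continuous fun U : unitaryGroup n ℂ => (tensorPow t U.1 * ρ * (tensorPow t U.1)ᴴ) x y := by
  have hT : Continuous fun U : unitaryGroup n ℂ => tensorPow t U.1 := by
    refine continuous_matrix fun a b => ?_
    have hv : Continuous fun U : unitaryGroup n ℂ => U.1 := continuous_subtype_val
    simp only [tensorPow, Matrix.of_apply]
    exact continuous_finsetProd _ fun k _ => hv.matrix_elem (a k) (b k)
  exact ((hT.matrix_mul continuous_const).matrix_mul hT.matrix_conjTranspose).matrix_elem x y

/-- Fubini, with conjugation by the outer unitary pulled out of the inner integral; independence of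
the gates enters here. -/
theorem momentOp_mconv (t : ℕ) (μ ν : Measure (unitaryGroup n ℂ)) [IsProbabilityMeasure μ]
    [IsProbabilityMeasure ν] [IsProbabilityMeasure (Measure.mconv μ ν)] :
    momentOp t (Measure.mconv μ ν) = momentOp t μ ∘ₗ momentOp t ν := by
  ext1 ρ
  ext x y
  have hint : Integrable (fun U : unitaryGroup n ℂ =>
      (tensorPow t U.1 * ρ * (tensorPow t U.1)ᴴ) x y) (Measure.mconv μ ν) :=
    integrable_twirl t _ ρ x y
  change ∫ U, (tensorPow t U.1 * ρ * (tensorPow t U.1)ᴴ) x y ∂(Measure.mconv μ ν) =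
    ∫ U, (tensorPow t U.1 * (momentOp t ν ρ) * (tensorPow t U.1)ᴴ) x y ∂μ
  rw [integral_mconv hint]
  refine integral_congr_ae (Filter.Eventually.of_forall fun U => ?_)
  refine Eq.trans ?_ (apply_momentOp t ν
    (sandwichEntry (tensorPow t U.1) (tensorPow t U.1)ᴴ x y) ρ).symm
  refine integral_congr_ae (Filter.Eventually.of_forall fun V => ?_)
  simp only [sandwichEntry, LinearMap.coe_mk, AddHom.coe_mk, Submonoid.coe_mul, tensorPow_mul,
    conjTranspose_mul, Matrix.mul_assoc]

theorem momentOp_dirac_one (t : ℕ) [IsProbabilityMeasure (Measure.dirac (1 : unitaryGroup n ℂ))] :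
    momentOp t (Measure.dirac (1 : unitaryGroup n ℂ)) = LinearMap.id := by
  ext1 ρ
  ext x y
  change ∫ U : unitaryGroup n ℂ, (tensorPow t U.1 * ρ * (tensorPow t U.1)ᴴ) x y
    ∂(Measure.dirac 1) = ρ x y
  rw [integral_dirac]
  simp [tensorPow_one]

end Moments

/-! ### Moment operators of circuits -/

section Circuits

variable {N : ℕ}

theorem momentOp_circuitLaw_nil (t : ℕ) :
    momentOp t (circuitLaw ([] : Architecture N)) = LinearMap.id :=
  have : IsProbabilityMeasure (Measure.dirac (1 : unitaryGroup (Qubits N) ℂ)) :=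
    Measure.dirac.isProbabilityMeasure
  momentOp_dirac_one t

theorem momentOp_circuitLaw_cons (t : ℕ) (S : Finset (Fin N)) (A : Architecture N) :
    momentOp t (circuitLaw (S :: A)) =
      momentOp t (circuitLaw A) ∘ₗ momentOp t (gateLaw S) :=
  have : IsProbabilityMeasure (Measure.mconv (circuitLaw A) (gateLaw S)) :=
    instIsProbabilityMeasureCircuitLaw (S :: A)
  momentOp_mconv t _ _

theorem momentOp_circuitLaw_append (t : ℕ) (A B : Architecture N) :
    momentOp t (circuitLaw (A ++ B)) =
      momentOp t (circuitLaw B) ∘ₗ momentOp t (circuitLaw A) := by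
  induction A with
  | nil => rw [momentOp_circuitLaw_nil]; rfl
  | cons S A ih =>
    rw [momentOp_circuitLaw_cons, ← LinearMap.comp_assoc, ← ih]
    exact momentOp_circuitLaw_cons t S (A ++ B)

theorem momentOp_circuitLaw_repeated_succ (t : ℕ) (A : Architecture N) (d : ℕ) :
    momentOp t (circuitLaw (A.repeated (d + 1))) =
      momentOp t (circuitLaw (A.repeated d)) ∘ₗ momentOp t (circuitLaw A) := by
  rw [← momentOp_circuitLaw_append]
  rfl

end Circuits


/-! ### The commutant of U ⊗ U -/

section Commutant

variable {n : Type} [Fintype n] [DecidableEq n]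

/-- The operator exchanging the two tensor factors. -/
def flipMat (n : Type) [DecidableEq n] : Matrix (Fin 2 → n) (Fin 2 → n) ℂ :=
  Matrix.of fun x y => if x 0 = y 1 ∧ x 1 = y 0 then 1 else 0

theorem sum_finTwoArrow {M : Type*} [AddCommMonoid M] (f : (Fin 2 → n) → M) :
    ∑ x, f x = ∑ i, ∑ j, f ![i, j] := by
  rw [← (finTwoArrowEquiv n).symm.sum_comp, Fintype.sum_prod_type]
  rfl

theorem tensorPow_two_apply (U : Matrix n n ℂ) (x y : Fin 2 → n) :
    tensorPow 2 U x y = U (x 0) (y 0) * U (x 1) (y 1) := by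
  simp [tensorPow, Fin.prod_univ_two]

theorem flipMat_mul_apply (X : Matrix (Fin 2 → n) (Fin 2 → n) ℂ) (x y : Fin 2 → n) :
    (flipMat n * X) x y = X ![x 1, x 0] y := by
  rw [Matrix.mul_apply, sum_finTwoArrow]
  change ∑ i, ∑ j, (if x 0 = j ∧ x 1 = i then (1 : ℂ) else 0) * X ![i, j] y = _
  simp [ite_and, ite_mul]

theorem mul_flipMat_apply (X : Matrix (Fin 2 → n) (Fin 2 → n) ℂ) (x y : Fin 2 → n) :
    (X * flipMat n) x y = X x ![y 1, y 0] := by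
  rw [Matrix.mul_apply, sum_finTwoArrow]
  simp [flipMat, ite_and, mul_ite]

theorem flipMat_mul_tensorPow (U : Matrix n n ℂ) :
    flipMat n * tensorPow 2 U = tensorPow 2 U * flipMat n := by
  ext x y
  rw [flipMat_mul_apply, mul_flipMat_apply, tensorPow_two_apply, tensorPow_two_apply]
  simp [mul_comm]

/-- The unitary that permutes the basis. -/
def permUnitary (σ : Equiv.Perm n) : unitaryGroup n ℂ :=
  ⟨(1 : Matrix n n ℂ).submatrix id σ, by
    rw [mem_unitaryGroup_iff, star_eq_conjTranspose, conjTranspose_submatrix,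
      submatrix_mul_equiv]
    simp⟩

theorem permUnitary_apply (σ : Equiv.Perm n) (i j : n) :
    (permUnitary σ).1 i j = if i = σ j then 1 else 0 := by
  simp [permUnitary, Matrix.one_apply]

/-- The diagonal unitary with the entry `i` at one place and `1` elsewhere. -/
noncomputable def phaseUnitary (p : n) : unitaryGroup n ℂ :=
  ⟨diagonal fun i => if i = p then Complex.I else 1, by
    rw [mem_unitaryGroup_iff, star_eq_conjTranspose, diagonal_conjTranspose, diagonal_mul_diagonal,
      ← diagonal_one]
    congr 1
    funext i
    by_cases h : i = p <;> simp [h]⟩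

/-- A square root of the transposition of two basis vectors. -/
noncomputable def mixUnitary (p q : n) : unitaryGroup n ℂ :=
  ⟨((1 + Complex.I) / 2) • (1 : Matrix n n ℂ) +
      ((1 - Complex.I) / 2) • (permUnitary (Equiv.swap p q)).1, by
    have h1 : (permUnitary (Equiv.swap p q)).1ᴴ = (permUnitary (Equiv.swap p q)).1 := by
      ext i j
      rw [conjTranspose_apply, permUnitary_apply, permUnitary_apply]
      have : j = Equiv.swap p q i ↔ i = Equiv.swap p q j := by
        constructor <;> rintro rfl <;> simp
      simp [this, apply_ite star]
    have h2 := mem_unitaryGroup_iff.mp (permUnitary (Equiv.swap p q)).2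
    rw [star_eq_conjTranspose, h1] at h2
    rw [mem_unitaryGroup_iff, star_eq_conjTranspose, conjTranspose_add, conjTranspose_smul,
      conjTranspose_smul, h1, conjTranspose_one, Matrix.add_mul, Matrix.mul_add, Matrix.mul_add]
    simp only [Matrix.smul_mul, Matrix.mul_smul, Matrix.one_mul, Matrix.mul_one, h2, smul_smul]
    have hI := Complex.I_mul_I
    ext i j
    simp only [Matrix.add_apply, Matrix.smul_apply, smul_eq_mul, Complex.star_def, map_div₀,
      map_add, map_sub, map_one, Complex.conj_I, map_ofNat]
    linear_combination
      ((permUnitary (Equiv.swap p q)).1 i j / 2 - (1 : Matrix n n ℂ) i j / 2) * hI⟩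

theorem mixUnitary_apply (p q i j : n) : (mixUnitary p q).1 i j =
    (1 + Complex.I) / 2 * (if i = j then 1 else 0) +
      (1 - Complex.I) / 2 * (if i = Equiv.swap p q j then 1 else 0) := by
  rw [← permUnitary_apply, ← Matrix.one_apply]
  rfl

/-- The products 1, i, -1 distinguish the counts 0, 1, 2; a phase -1 would confuse 0 with 2. -/
theorem count_eq_of_phase_eq {a b c d : Prop} [Decidable a] [Decidable b] [Decidable c]
    [Decidable d]
    (h : (if a then Complex.I else 1) * (if b then Complex.I else 1) =
      (if c then Complex.I else 1) * (if d then Complex.I else 1)) :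
    (if a then 1 else 0) + (if b then 1 else 0) = (if c then 1 else 0) + (if d then 1 else 0) := by
  have h1 := congrArg Complex.re h
  have h2 := congrArg Complex.im h
  clear h
  revert h1 h2
  by_cases ha : a <;> by_cases hb : b <;> by_cases hc : c <;> by_cases hd : d <;>
    simp [ha, hb, hc, hd] <;> norm_num

/-- The commutant of the unitaries `U ⊗ U` is spanned by the identity and the flip. -/
theorem eq_smul_one_add_smul_flipMat [Nontrivial n] {Z : Matrix (Fin 2 → n) (Fin 2 → n) ℂ}
    (hZ : ∀ U : unitaryGroup n ℂ, Z * tensorPow 2 U.1 = tensorPow 2 U.1 * Z) :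
    ∃ a b : ℂ, Z = a • (1 : Matrix (Fin 2 → n) (Fin 2 → n) ℂ) + b • flipMat n := by
  have key : ∀ (U : unitaryGroup n ℂ) (p q r s : n),
      ∑ i, ∑ j, Z ![p, q] ![i, j] * (U.1 i r * U.1 j s) =
        ∑ i, ∑ j, U.1 p i * U.1 q j * Z ![i, j] ![r, s] := by
    intro U p q r s
    have h := congrFun (congrFun (hZ U) ![p, q]) ![r, s]
    rw [Matrix.mul_apply, Matrix.mul_apply, sum_finTwoArrow, sum_finTwoArrow] at h
    simpa [tensorPow_two_apply] using h
  have hperm : ∀ (σ : Equiv.Perm n) (p q r s : n),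
      Z ![σ p, σ q] ![σ r, σ s] = Z ![p, q] ![r, s] := by
    intro σ p q r s
    have h := key (permUnitary σ) (σ p) (σ q) r s
    simpa [permUnitary_apply, ite_and] using h
  have hdiag : ∀ t p q r s : n, Z ![p, q] ![r, s] ≠ 0 →
      (if r = t then 1 else 0) + (if s = t then 1 else 0) =
        (if p = t then 1 else 0) + (if q = t then 1 else 0) := by
    intro t p q r s hne
    have h := key (phaseUnitary t) p q r s
    obtain ⟨f, hf⟩ : ∃ f : n → ℂ, f = fun i => if i = t then Complex.I else 1 := ⟨_, rfl⟩
    have hU : ∀ i j, (phaseUnitary t).1 i j = if i = j then f i else 0 := by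
      intro i j
      rw [hf]
      rfl
    simp only [hU, mul_ite, ite_mul, mul_zero, zero_mul, Finset.sum_ite_eq, Finset.sum_ite_eq',
      Finset.mem_univ, if_true] at h
    have h' : f r * f s = f p * f q := mul_left_cancel₀ hne (by rw [h, mul_comm])
    rw [hf] at h'
    exact count_eq_of_phase_eq h'
  -- Diagonal phases force row and column indices to agree as multisets, leaving only the supports
  -- of the identity and the flip.
  have hsupp : ∀ p q r s : n, Z ![p, q] ![r, s] ≠ 0 → (p = r ∧ q = s) ∨ (p = s ∧ q = r) := by
    intro p q r s hne
    have h1 := hdiag p p q r s hne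
    have h2 := hdiag q p q r s hne
    clear hdiag hperm key hZ
    grind
  -- Permutations and phases still allow an independent coefficient at (pp, pp). The entry (pp, pq)
  -- of the commutation relation with `mixUnitary` removes it: both sides carry the factor (1 + i)/2
  -- · (1 - i)/2 = 1/2.
  have hmix : ∀ p q : n, p ≠ q →
      Z ![p, p] ![p, p] = Z ![p, q] ![p, q] + Z ![q, p] ![p, q] := by
    intro p q hpq
    have h := key (mixUnitary p q) p p p q
    have hL : ∀ i j, Z ![p, p] ![i, j] * ((mixUnitary p q).1 i p * (mixUnitary p q).1 j q) =
        if i = p then if j = p then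
          Z ![p, p] ![i, j] * ((mixUnitary p q).1 i p * (mixUnitary p q).1 j q) else 0 else 0 := by
      intro i j
      by_cases h0 : Z ![p, p] ![i, j] = 0
      · simp [h0]
      · have := hsupp _ _ _ _ h0
        have hi : i = p := by grind
        have hj : j = p := by grind
        simp [hi, hj]
    have hR : ∀ i j, (mixUnitary p q).1 p i * (mixUnitary p q).1 p j * Z ![i, j] ![p, q] =
        (if i = p then if j = q then
          (mixUnitary p q).1 p i * (mixUnitary p q).1 p j * Z ![i, j] ![p, q] else 0 else 0) +
        (if i = q then if j = p then
          (mixUnitary p q).1 p i * (mixUnitary p q).1 p j * Z ![i, j] ![p, q] else 0 else 0) := by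
      intro i j
      by_cases h0 : Z ![i, j] ![p, q] = 0
      · simp [h0]
      · rcases hsupp _ _ _ _ h0 with ⟨rfl, rfl⟩ | ⟨rfl, rfl⟩
        · simp [hpq]
        · simp [Ne.symm hpq]
    rw [Finset.sum_congr rfl fun i _ => Finset.sum_congr rfl fun j _ => hL i j,
      Finset.sum_congr rfl fun i _ => Finset.sum_congr rfl fun j _ => hR i j] at h
    simp only [Finset.sum_add_distrib, Finset.sum_ite_irrel, Finset.sum_ite_eq',
      Finset.sum_const_zero, Finset.mem_univ, if_true] at h
    have e1 : (mixUnitary p q).1 p p = (1 + Complex.I) / 2 := by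
      simp [mixUnitary_apply, hpq]
    have e2 : (mixUnitary p q).1 p q = (1 - Complex.I) / 2 := by
      simp [mixUnitary_apply, hpq]
    rw [e1, e2] at h
    have hI := Complex.I_mul_I
    linear_combination 2 * h - (Z ![p, q] ![p, q] / 2 + Z ![q, p] ![p, q] / 2
      - Z ![p, p] ![p, p] / 2) * hI
  obtain ⟨p, q, hpq⟩ := exists_pair_ne n
  have htrans : ∀ r s : n, r ≠ s → ∃ σ : Equiv.Perm n, σ p = r ∧ σ q = s := by
    intro r s hrs
    exact MulAction.is_two_pretransitive_iff.mp
      (Equiv.Perm.isMultiplyPretransitive n 2) hpq hrs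
  -- Two-transitivity of the permutations makes one pair p ≠ q determine both coefficients.
  refine ⟨Z ![p, q] ![p, q], Z ![q, p] ![p, q], ?_⟩
  have hne : ∀ r s : n, r ≠ s → Z ![r, s] ![r, s] = Z ![p, q] ![p, q] ∧
      Z ![s, r] ![r, s] = Z ![q, p] ![p, q] := by
    intro r s hrs
    obtain ⟨σ, rfl, rfl⟩ := htrans r s hrs
    exact ⟨hperm σ p q p q, hperm σ q p p q⟩
  have hsame : ∀ r : n, Z ![r, r] ![r, r] = Z ![p, q] ![p, q] + Z ![q, p] ![p, q] := by
    intro r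
    obtain ⟨s, hs⟩ := exists_ne r
    rw [hmix r s hs.symm, (hne r s hs.symm).1, (hne r s hs.symm).2]
  have hall : ∀ i j k l : n, Z ![i, j] ![k, l] =
      Z ![p, q] ![p, q] * (if i = k ∧ j = l then 1 else 0) +
        Z ![q, p] ![p, q] * (if i = l ∧ j = k then 1 else 0) := by
    intro i j k l
    by_cases h0 : Z ![i, j] ![k, l] = 0
    · by_cases hkl : k = l
      · subst hkl
        by_cases h1 : i = k ∧ j = k
        · obtain ⟨rfl, rfl⟩ := h1
          simpa using hsame _
        · simp [h0, h1]
      · by_cases h1 : i = k ∧ j = l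
        · obtain ⟨rfl, rfl⟩ := h1
          simp [(hne i j hkl).1, hkl]
        · by_cases h2 : i = l ∧ j = k
          · obtain ⟨rfl, rfl⟩ := h2
            simp [(hne j i hkl).2, Ne.symm hkl]
          · simp [h0, h1, h2]
    · rcases hsupp i j k l h0 with ⟨rfl, rfl⟩ | ⟨rfl, rfl⟩
      · by_cases hij : i = j
        · subst hij
          simpa using hsame i
        · simp [(hne i j hij).1, hij]
      · by_cases hij : i = j
        · subst hij
          simpa using hsame _
        · simp [(hne _ _ (Ne.symm hij)).2, hij]
  ext x y
  have hx : ∀ x : Fin 2 → n, x = ![x 0, x 1] := fun x => by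
    ext i; fin_cases i <;> rfl
  rw [hx x, hx y, hall]
  simp [flipMat, Matrix.one_apply]

end Commutant


/-! ### The second Haar moment in closed form -/

section HaarMoment

variable {n : Type} [Fintype n] [DecidableEq n]

instance instIsHaarMeasureHaarUnitary : (haarUnitary n).IsHaarMeasure := by
  unfold haarUnitary
  infer_instance

theorem haar_twirl_invariant (t : ℕ) (X : Matrix (Fin t → n) (Fin t → n) ℂ)
    (V : unitaryGroup n ℂ) :
    tensorPow t V.1 * momentOp t (haarUnitary n) X * (tensorPow t V.1)ᴴ =
      momentOp t (haarUnitary n) X := by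
  ext x y
  refine (apply_momentOp t (haarUnitary n)
    (sandwichEntry (tensorPow t V.1) (tensorPow t V.1)ᴴ x y) X).trans ?_
  refine Eq.trans ?_ (integral_mul_left_eq_self (μ := haarUnitary n)
    (fun U : unitaryGroup n ℂ => (tensorPow t U.1 * X * (tensorPow t U.1)ᴴ) x y) V)
  refine integral_congr_ae (Filter.Eventually.of_forall fun U => ?_)
  simp only [sandwichEntry, LinearMap.coe_mk, AddHom.coe_mk, Submonoid.coe_mul, tensorPow_mul,
    conjTranspose_mul, Matrix.mul_assoc]

theorem haar_twirl_commute (t : ℕ) (X : Matrix (Fin t → n) (Fin t → n) ℂ)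
    (V : unitaryGroup n ℂ) :
    momentOp t (haarUnitary n) X * tensorPow t V.1 =
      tensorPow t V.1 * momentOp t (haarUnitary n) X := by
  conv_lhs => rw [← haar_twirl_invariant t X V]
  rw [Matrix.mul_assoc, tensorPow_unitary', Matrix.mul_one]

/-- Cyclicity of the trace makes the integrand constant. With `B` the identity or the flip this
gives two conserved quantities. -/
theorem trace_mul_momentOp (t : ℕ) (ν : Measure (unitaryGroup n ℂ)) [IsProbabilityMeasure ν]
    (B X : Matrix (Fin t → n) (Fin t → n) ℂ)
    (hB : ∀ U : unitaryGroup n ℂ, B * tensorPow t U.1 = tensorPow t U.1 * B) :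
    (B * momentOp t ν X).trace = (B * X).trace := by
  refine (apply_momentOp t ν
    ((traceLinearMap _ ℂ ℂ) ∘ₗ (LinearMap.mulLeft ℂ B)) X).trans ?_
  have h : ∀ U : unitaryGroup n ℂ, ((traceLinearMap _ ℂ ℂ) ∘ₗ (LinearMap.mulLeft ℂ B))
      (tensorPow t U.1 * X * (tensorPow t U.1)ᴴ) = (B * X).trace := by
    intro U
    simp only [LinearMap.comp_apply, LinearMap.mulLeft_apply, traceLinearMap_apply]
    rw [← Matrix.mul_assoc, ← Matrix.mul_assoc, hB, Matrix.trace_mul_comm, ← Matrix.mul_assoc,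
      ← Matrix.mul_assoc, tensorPow_unitary', Matrix.one_mul]
  simp only [h]
  simp

theorem trace_momentOp (t : ℕ) (ν : Measure (unitaryGroup n ℂ)) [IsProbabilityMeasure ν]
    (X : Matrix (Fin t → n) (Fin t → n) ℂ) : (momentOp t ν X).trace = X.trace := by
  simpa using trace_mul_momentOp t ν 1 X (by simp)

theorem trace_flipMat : (flipMat n).trace = Fintype.card n := by
  rw [Matrix.trace, sum_finTwoArrow]
  change ∑ i : n, ∑ j : n, (if i = j ∧ j = i then (1 : ℂ) else 0) = _
  simp [ite_and]

theorem flipMat_mul_flipMat : flipMat n * flipMat n = 1 := by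
  ext x y
  rw [flipMat_mul_apply]
  simp [flipMat, Matrix.one_apply, funext_iff, Fin.forall_fin_two, and_comm]

/-- The coefficient of the identity in the second Haar moment. -/
noncomputable def haarCoeffOne (X : Matrix (Fin 2 → n) (Fin 2 → n) ℂ) : ℂ :=
  (Fintype.card n * X.trace - (flipMat n * X).trace) /
    (Fintype.card n * ((Fintype.card n : ℂ) ^ 2 - 1))

/-- The coefficient of the flip in the second Haar moment. -/
noncomputable def haarCoeffFlip (X : Matrix (Fin 2 → n) (Fin 2 → n) ℂ) : ℂ :=
  (Fintype.card n * (flipMat n * X).trace - X.trace) /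
    (Fintype.card n * ((Fintype.card n : ℂ) ^ 2 - 1))

/-- By invariance the result lies in the commutant; the conserved traces of X and of flip · X then
give a 2 × 2 linear system, solvable since the dimension exceeds 1. -/
theorem momentOp_two_haar [Nontrivial n] (X : Matrix (Fin 2 → n) (Fin 2 → n) ℂ) :
    momentOp 2 (haarUnitary n) X =
      haarCoeffOne X • (1 : Matrix (Fin 2 → n) (Fin 2 → n) ℂ) + haarCoeffFlip X • flipMat n := by
  obtain ⟨a, b, h⟩ := eq_smul_one_add_smul_flipMat (haar_twirl_commute 2 X)
  have h1 := trace_momentOp 2 (haarUnitary n) X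
  have h2 := trace_mul_momentOp 2 (haarUnitary n) (flipMat n) X
    fun U => flipMat_mul_tensorPow U.1
  have hc : (1 : ℕ) < Fintype.card n := Fintype.one_lt_card
  rw [h] at h1 h2 ⊢
  rw [Matrix.mul_add, Matrix.mul_smul, Matrix.mul_smul, flipMat_mul_flipMat, Matrix.mul_one] at h2
  simp only [trace_add, trace_smul, trace_one, trace_flipMat, smul_eq_mul, Fintype.card_fun,
    Fintype.card_fin, Nat.cast_pow] at h1 h2
  have hn : (Fintype.card n : ℂ) ≠ 0 := by
    have : Fintype.card n ≠ 0 := by omega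
    exact_mod_cast this
  have hn2 : (Fintype.card n : ℂ) ^ 2 - 1 ≠ 0 := by
    have : Fintype.card n ^ 2 ≠ 1 := by nlinarith
    exact sub_ne_zero.mpr (by exact_mod_cast this)
  have ha : a = haarCoeffOne X := by
    rw [haarCoeffOne, ← h1, ← h2]
    field_simp
    ring
  have hb : b = haarCoeffFlip X := by
    rw [haarCoeffFlip, ← h1, ← h2]
    field_simp
    ring
  rw [ha, hb]

/-- The Haar moment sees an operator only through the two conserved traces. -/
theorem momentOp_haar_momentOp [Nontrivial n] (ν : Measure (unitaryGroup n ℂ))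
    [IsProbabilityMeasure ν] :
    momentOp 2 (haarUnitary n) ∘ₗ momentOp 2 ν = momentOp 2 (haarUnitary n) := by
  ext1 X
  rw [LinearMap.comp_apply, momentOp_two_haar, momentOp_two_haar, haarCoeffOne, haarCoeffFlip,
    trace_momentOp, trace_mul_momentOp 2 ν (flipMat n) X fun U => flipMat_mul_tensorPow U.1]
  rfl

end HaarMoment

/-! ### A gate on part of the sites acts block by block -/

section Blocks

/-- The block of `X` at the position `(o, o')` of the second index. -/
def blockAt {m k : Type} (X : Matrix (m × k) (m × k) ℂ) (o o' : k) : Matrix m m ℂ :=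
  Matrix.of fun i j => X (i, o) (j, o')

theorem kronecker_one_conj_apply {m k : Type} [Fintype m] [Fintype k] [DecidableEq k]
    (A B : Matrix m m ℂ) (X : Matrix (m × k) (m × k) ℂ) (a b : m × k) :
    ((A ⊗ₖ (1 : Matrix k k ℂ)) * X * (B ⊗ₖ (1 : Matrix k k ℂ))) a b =
      (A * blockAt X a.2 b.2 * B) a.1 b.1 := by
  simp only [Matrix.mul_apply, kroneckerMap_apply, Fintype.sum_prod_type, Matrix.one_apply,
    blockAt, of_apply]
  simp

variable {N : ℕ}

/-- Splitting a pair of basis states into their parts inside and outside `S`. -/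
def splitPair (S : Finset (Fin N)) : (Fin 2 → Qubits N) ≃
    (Fin 2 → QubitsOn S) × (Fin 2 → ({i : Fin N // i ∉ S} → Fin 2)) :=
  ((Equiv.refl (Fin 2)).arrowCongr (splitQubits S)).trans (Equiv.arrowProdEquivProdArrow _ _ _)

theorem tensorPow_embedGate (S : Finset (Fin N)) (U : unitaryGroup (QubitsOn S) ℂ) :
    tensorPow 2 (embedGate S U).1 = ((tensorPow 2 U.1) ⊗ₖ (1 : Matrix
      (Fin 2 → ({i : Fin N // i ∉ S} → Fin 2)) (Fin 2 → ({i : Fin N // i ∉ S} → Fin 2)) ℂ)).submatrix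
        (splitPair S) (splitPair S) := by
  rw [← tensorPow_one]
  ext x y
  simp only [tensorPow, of_apply, submatrix_apply, kroneckerMap_apply, embedGate,
    Finset.prod_mul_distrib]
  rfl

/-- The blocks of an operator with respect to the sites outside `S`. -/
def gateBlock (S : Finset (Fin N)) (X : Matrix (Fin 2 → Qubits N) (Fin 2 → Qubits N) ℂ)
    (x y : Fin 2 → Qubits N) : Matrix (Fin 2 → QubitsOn S) (Fin 2 → QubitsOn S) ℂ :=
  blockAt (X.submatrix (splitPair S).symm (splitPair S).symm) (splitPair S x).2 (splitPair S y).2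

/-- Conjugation by U ⊗ 1 never mixes blocks with different indices outside `S`, so the closed
formula for the full Haar moment applies to each block. -/
theorem momentOp_gateLaw_apply (S : Finset (Fin N))
    (X : Matrix (Fin 2 → Qubits N) (Fin 2 → Qubits N) ℂ) (x y : Fin 2 → Qubits N) :
    momentOp 2 (gateLaw S) X x y = momentOp 2 (haarUnitary (QubitsOn S)) (gateBlock S X x y)
      (splitPair S x).1 (splitPair S y).1 := by
  change ∫ U, (tensorPow 2 U.1 * X * (tensorPow 2 U.1)ᴴ) x y ∂(gateLaw S) =
    ∫ U : unitaryGroup (QubitsOn S) ℂ, (tensorPow 2 U.1 * gateBlock S X x y * (tensorPow 2 U.1)ᴴ)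
      (splitPair S x).1 (splitPair S y).1 ∂(haarUnitary (QubitsOn S))
  rw [gateLaw, integral_map (continuous_embedGate S).measurable.aemeasurable
    (continuous_twirl 2 X x y).aestronglyMeasurable]
  refine integral_congr_ae (Filter.Eventually.of_forall fun U => ?_)
  simp only
  rw [tensorPow_embedGate, gateBlock, ← kronecker_one_conj_apply]
  have hX : X = (X.submatrix (splitPair S).symm (splitPair S).symm).submatrix
      (splitPair S) (splitPair S) := by
    simp
  conv_lhs => rw [hX]
  rw [conjTranspose_submatrix, submatrix_mul_equiv, submatrix_mul_equiv, conjTranspose_kronecker,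
    conjTranspose_one]
  rfl

end Blocks


/-! ### Products of sitewise identities and flips -/

section SwapOperators

/-- The identity (`false`) or the flip (`true`) on the two copies of one qubit. -/
def siteFactor (b : Bool) (x y : Fin 2 → Fin 2) : ℂ :=
  bif b then (if x 0 = y 1 ∧ x 1 = y 0 then 1 else 0) else (if x 0 = y 0 ∧ x 1 = y 1 then 1 else 0)

theorem one_apply_eq_prod {ι : Type} [Fintype ι] [DecidableEq ι] (x y : Fin 2 → ι → Fin 2) :
    (1 : Matrix (Fin 2 → ι → Fin 2) (Fin 2 → ι → Fin 2) ℂ) x y =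
      ∏ i, siteFactor false (fun k => x k i) (fun k => y k i) := by
  simp only [siteFactor, cond_false, Finset.prod_ite_zero, Finset.prod_const_one, Matrix.one_apply,
    Finset.mem_univ, forall_and, ← funext_iff]
  simp [funext_iff, Fin.forall_fin_two]

theorem flipMat_apply_eq_prod {ι : Type} [Fintype ι] [DecidableEq ι] (x y : Fin 2 → ι → Fin 2) :
    flipMat (ι → Fin 2) x y = ∏ i, siteFactor true (fun k => x k i) (fun k => y k i) := by
  simp only [siteFactor, cond_true, Finset.prod_ite_zero, Finset.prod_const_one, flipMat, of_apply,
    Finset.mem_univ, true_implies, forall_and]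
  simp [funext_iff]

/-- The operator that exchanges the two copies of the sites `i` with `g i = true`. -/
def swapOp {ι : Type} [Fintype ι] (g : ι → Bool) :
    Matrix (Fin 2 → ι → Fin 2) (Fin 2 → ι → Fin 2) ℂ :=
  Matrix.of fun x y => ∏ i, siteFactor (g i) (fun k => x k i) (fun k => y k i)

theorem sum_prod_sites {ι : Type} [Fintype ι] [DecidableEq ι]
    (f : ι → (Fin 2 → Fin 2) → ℂ) :
    ∑ x : Fin 2 → ι → Fin 2, ∏ i, f i (fun k => x k i) = ∏ i, ∑ u, f i u := by
  rw [Finset.prod_univ_sum, Fintype.piFinset_univ,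
    ← (Equiv.piComm fun (_ : Fin 2) (_ : ι) => Fin 2).sum_comp]
  rfl

/-- The trace factors over the sites; on two copies of a qubit the identity has trace 4 and the flip
trace 2. -/
theorem trace_swapOp {ι : Type} [Fintype ι] [DecidableEq ι] (g : ι → Bool) :
    (swapOp g).trace = ∏ i, bif g i then 2 else 4 := by
  change ∑ x : Fin 2 → ι → Fin 2,
    ∏ i, siteFactor (g i) (fun k => x k i) (fun k => x k i) = _
  rw [sum_prod_sites fun i u => siteFactor (g i) u u]
  refine Finset.prod_congr rfl fun i _ => ?_
  rw [sum_finTwoArrow]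
  simp only [Fin.sum_univ_two]
  cases g i <;> norm_num [siteFactor]

theorem trace_flipMat_mul_swapOp {ι : Type} [Fintype ι] [DecidableEq ι] (g : ι → Bool) :
    (flipMat (ι → Fin 2) * swapOp g).trace = ∏ i, bif g i then 4 else 2 := by
  have h : flipMat (ι → Fin 2) * swapOp g = swapOp fun i => !(g i) := by
    ext x y
    rw [flipMat_mul_apply]
    refine Finset.prod_congr rfl fun i _ => ?_
    change siteFactor (g i) (fun k => (![x 1, x 0] : Fin 2 → ι → Fin 2) k i) (fun k => y k i) =
      siteFactor (!(g i)) (fun k => x k i) (fun k => y k i)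
    generalize g i = b
    cases b <;> simp [siteFactor, and_comm]
  rw [h, trace_swapOp]
  refine Finset.prod_congr rfl fun i _ => ?_
  cases g i <;> rfl

variable {N : ℕ}

theorem prod_split_sites (S : Finset (Fin N)) (f : Fin N → ℂ) :
    ∏ i, f i = (∏ i : {i : Fin N // i ∈ S}, f i) * ∏ i : {i : Fin N // i ∉ S}, f i := by
  rw [← Fintype.prod_subtype_mul_prod_subtype (fun i => i ∈ S)]
  congr!

/-- A gate on `S` sends an operator that is a product of identities and flips outside `S` to a
combination of products of identities and flips. -/
theorem momentOp_gateLaw_of_prod (S : Finset (Fin N)) (hS : S.Nonempty)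
    (X : Matrix (Fin 2 → Qubits N) (Fin 2 → Qubits N) ℂ) (g : Fin N → Bool)
    (W : Matrix (Fin 2 → QubitsOn S) (Fin 2 → QubitsOn S) ℂ)
    (hX : ∀ x y, X x y = W (fun k i => x k i) (fun k i => y k i) *
      ∏ i : {i : Fin N // i ∉ S}, siteFactor (g i) (fun k => x k i) (fun k => y k i)) :
    momentOp 2 (gateLaw S) X =
      haarCoeffOne W • swapOp (fun i => if i ∈ S then false else g i) +
        haarCoeffFlip W • swapOp (fun i => if i ∈ S then true else g i) := by
  have : Nonempty {i : Fin N // i ∈ S} := hS.to_subtype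
  ext x y
  obtain ⟨c, hc⟩ : ∃ c, c = ∏ i : {i : Fin N // i ∉ S},
    siteFactor (g i) (fun k => x k i) (fun k => y k i) := ⟨_, rfl⟩
  -- The factors outside `S` are constant on a block, so all blocks are multiples of the same `W`.
  have hb : gateBlock S X x y = c • W := by
    ext s s'
    have h1 : ∀ (z : Fin 2 → Qubits N) (s : Fin 2 → QubitsOn S) (k : Fin 2)
        (i : {i : Fin N // i ∈ S}), (splitPair S).symm (s, (splitPair S z).2) k i = s k i := by
      intro z s k i
      have := congrFun (congrFun (congrArg Prod.fst
        ((splitPair S).apply_symm_apply (s, (splitPair S z).2))) k) i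
      exact this
    have h2 : ∀ (z : Fin 2 → Qubits N) (s : Fin 2 → QubitsOn S) (k : Fin 2)
        (i : {i : Fin N // i ∉ S}), (splitPair S).symm (s, (splitPair S z).2) k i = z k i := by
      intro z s k i
      have := congrFun (congrFun (congrArg Prod.snd
        ((splitPair S).apply_symm_apply (s, (splitPair S z).2))) k) i
      exact this
    change X ((splitPair S).symm (s, (splitPair S x).2))
      ((splitPair S).symm (s', (splitPair S y).2)) = c * W s s'
    rw [hX, hc, mul_comm]
    simp only [h1, h2]
  have hsw : ∀ b : Bool, swapOp (fun i => if i ∈ S then b else g i) x y =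
      (∏ i : {i : Fin N // i ∈ S}, siteFactor b (fun k => x k i) (fun k => y k i)) * c := by
    intro b
    rw [hc, swapOp, of_apply, prod_split_sites S]
    congr 1
    · exact Finset.prod_congr rfl fun i _ => by rw [if_pos i.2]
    · exact Finset.prod_congr rfl fun i _ => by rw [if_neg i.2]
  rw [momentOp_gateLaw_apply, hb, map_smul, momentOp_two_haar]
  simp only [Matrix.add_apply, Matrix.smul_apply, smul_eq_mul, one_apply_eq_prod,
    flipMat_apply_eq_prod, hsw]
  have h1 : ∀ (z : Fin 2 → Qubits N) (k : Fin 2) (i : {i : Fin N // i ∈ S}),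
      (splitPair S z).1 k i = z k i := fun _ _ _ => rfl
  simp only [h1]
  ring

/-- Here `m` is the dimension of the gate, `t` the trace of the restricted operator and `u` its
trace against the flip; passing them with equations lets each application supply closed forms. -/
theorem momentOp_gateLaw_swapOp (S : Finset (Fin N)) (hS : S.Nonempty) (g : Fin N → Bool)
    (m t u : ℂ) (hm : m = ∏ _i ∈ S, 2) (ht : t = ∏ i ∈ S, bif g i then 2 else 4)
    (hu : u = ∏ i ∈ S, bif g i then 4 else 2) :
    momentOp 2 (gateLaw S) (swapOp g) =
      ((m * t - u) / (m * (m ^ 2 - 1))) • swapOp (fun i => if i ∈ S then false else g i) +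
        ((m * u - t) / (m * (m ^ 2 - 1))) • swapOp (fun i => if i ∈ S then true else g i) := by
  have hcard : (Fintype.card (QubitsOn S) : ℂ) = m := by
    rw [hm]
    simp
  have h1 : (swapOp fun i : {i : Fin N // i ∈ S} => g i).trace = t := by
    rw [trace_swapOp, ht]
    exact Finset.prod_coe_sort S fun i => bif g i then (2 : ℂ) else 4
  have h2 : (flipMat (QubitsOn S) * swapOp fun i : {i : Fin N // i ∈ S} => g i).trace = u := by
    rw [trace_flipMat_mul_swapOp, hu]
    exact Finset.prod_coe_sort S fun i => bif g i then (4 : ℂ) else 2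
  rw [momentOp_gateLaw_of_prod S hS (swapOp g) g (swapOp fun i : {i : Fin N // i ∈ S} => g i),
    haarCoeffOne, haarCoeffFlip, hcard, h1, h2]
  intro x y
  exact prod_split_sites S fun i => siteFactor (g i) (fun k => x k i) (fun k => y k i)

end SwapOperators


/-! ### The action of the three kinds of gate on label patterns -/

section Period

variable {M : ℕ}

/-- A function on the sites that is constant on all sites but the first two. -/
def threePart (M : ℕ) (a b c : Bool) : Fin (M + 2) → Bool :=
  Fin.cases a (Fin.cases b fun _ => c)

/-- The exchange of the two copies of the first site (if `a`), of the second site (if `b`) and of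
the other sites (if `c`). -/
def partSwap (M : ℕ) (a b c : Bool) :
    Matrix (Fin 2 → Qubits (M + 2)) (Fin 2 → Qubits (M + 2)) ℂ :=
  swapOp (threePart M a b c)

theorem prod_three {S : Finset (Fin (M + 2))} (f : Fin (M + 2) → ℂ) :
    ∏ i ∈ S, f i = (if 0 ∈ S then f 0 else 1) * ((if 1 ∈ S then f 1 else 1) *
      ∏ j : Fin M, if j.succ.succ ∈ S then f j.succ.succ else 1) := by
  rw [← Finset.prod_ite_mem_eq, Fin.prod_univ_succ, Fin.prod_univ_succ]
  rfl

theorem one_mem_exceptFirst : (1 : Fin (M + 2)) ∈ exceptFirst (M + 2) := by simp [exceptFirst]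
theorem zero_notMem_exceptFirst : (0 : Fin (M + 2)) ∉ exceptFirst (M + 2) := by simp [exceptFirst]
theorem succ_mem_exceptFirst (j : Fin M) : j.succ.succ ∈ exceptFirst (M + 2) := by
  simp [exceptFirst]
theorem one_notMem_exceptSecond : (1 : Fin (M + 2)) ∉ exceptSecond (M + 2) := by
  simp [exceptSecond]
theorem zero_mem_exceptSecond : (0 : Fin (M + 2)) ∈ exceptSecond (M + 2) := by
  simp [exceptSecond]
theorem succ_mem_exceptSecond (j : Fin M) : j.succ.succ ∈ exceptSecond (M + 2) := by
  simp [exceptSecond]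
theorem one_mem_firstTwo : (1 : Fin (M + 2)) ∈ firstTwo (M + 2) := by simp [firstTwo]
theorem zero_mem_firstTwo : (0 : Fin (M + 2)) ∈ firstTwo (M + 2) := by simp [firstTwo]
theorem succ_notMem_firstTwo (j : Fin M) : j.succ.succ ∉ firstTwo (M + 2) := by
  simp [firstTwo]

theorem threePart_exceptFirst (a b c d : Bool) :
    (fun i => if i ∈ exceptFirst (M + 2) then d else threePart M a b c i) =
      threePart M a d d := by
  funext i
  refine Fin.cases ?_ (fun i => Fin.cases ?_ (fun j => ?_) i) i
  · rw [if_neg zero_notMem_exceptFirst]; rfl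
  · exact if_pos one_mem_exceptFirst
  · exact if_pos (succ_mem_exceptFirst j)

theorem threePart_exceptSecond (a b c d : Bool) :
    (fun i => if i ∈ exceptSecond (M + 2) then d else threePart M a b c i) =
      threePart M d b d := by
  funext i
  refine Fin.cases ?_ (fun i => Fin.cases ?_ (fun j => ?_) i) i
  · exact if_pos zero_mem_exceptSecond
  · exact if_neg one_notMem_exceptSecond
  · exact if_pos (succ_mem_exceptSecond j)

theorem threePart_firstTwo (a b c d : Bool) :
    (fun i => if i ∈ firstTwo (M + 2) then d else threePart M a b c i) =
      threePart M d d c := by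
  funext i
  refine Fin.cases ?_ (fun i => Fin.cases ?_ (fun j => ?_) i) i
  · exact if_pos zero_mem_firstTwo
  · exact if_pos one_mem_firstTwo
  · exact if_neg (succ_notMem_firstTwo j)

/-- The weight with which a gate on one plus `M` sites, of which either the `M` sites or the one
are flipped, returns the state of the single site. -/
noncomputable def smallWeight (M : ℕ) : ℝ := 3 * 2 ^ M / (4 * (2 ^ M) ^ 2 - 1)

/-- The weight with which a gate on one plus `M` sites, of which either the `M` sites or the one
are flipped, returns the state of the `M` sites. -/
noncomputable def largeWeight (M : ℕ) : ℝ := 2 * ((2 ^ M) ^ 2 - 1) / (4 * (2 ^ M) ^ 2 - 1)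

theorem four_pow_eq : (4 : ℂ) ^ M = (2 ^ M) ^ 2 := by
  rw [← pow_mul, mul_comm, pow_mul]; norm_num

theorem dim_ne : (4 * (2 ^ M) ^ 2 - 1 : ℂ) ≠ 0 := by
  have h : (1 : ℕ) ≤ 2 ^ M := Nat.one_le_two_pow
  have h2 : 4 * (2 ^ M) ^ 2 ≠ 1 := by nlinarith
  exact sub_ne_zero.mpr (by exact_mod_cast h2)

theorem gate_exceptFirst (a b c : Bool) (t u : ℂ)
    (ht : t = (bif b then 2 else 4) * (bif c then 2 else 4) ^ M)
    (hu : u = (bif b then 4 else 2) * (bif c then 4 else 2) ^ M) :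
    momentOp 2 (gateLaw (exceptFirst (M + 2))) (partSwap M a b c) =
      ((2 * 2 ^ M * t - u) / (2 * 2 ^ M * ((2 * 2 ^ M) ^ 2 - 1))) • partSwap M a false false +
      ((2 * 2 ^ M * u - t) / (2 * 2 ^ M * ((2 * 2 ^ M) ^ 2 - 1))) • partSwap M a true true := by
  rw [partSwap, momentOp_gateLaw_swapOp _ ⟨1, one_mem_exceptFirst⟩ _ (2 * 2 ^ M) t u,
    threePart_exceptFirst, threePart_exceptFirst]
  · rfl
  · rw [prod_three]
    simp only [one_mem_exceptFirst, zero_notMem_exceptFirst, succ_mem_exceptFirst, if_true,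
      if_false, Finset.prod_const, Finset.card_univ, Fintype.card_fin, one_mul]
  · rw [prod_three, ht]
    simp only [one_mem_exceptFirst, zero_notMem_exceptFirst, succ_mem_exceptFirst, if_true,
      if_false, one_mul]
    change _ = (bif b then 2 else 4) * ∏ j : Fin M, (bif c then (2 : ℂ) else 4)
    simp
  · rw [prod_three, hu]
    simp only [one_mem_exceptFirst, zero_notMem_exceptFirst, succ_mem_exceptFirst, if_true,
      if_false, one_mul]
    change _ = (bif b then 4 else 2) * ∏ j : Fin M, (bif c then (4 : ℂ) else 2)
    simp

theorem gate_exceptSecond (a b c : Bool) (t u : ℂ)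
    (ht : t = (bif a then 2 else 4) * (bif c then 2 else 4) ^ M)
    (hu : u = (bif a then 4 else 2) * (bif c then 4 else 2) ^ M) :
    momentOp 2 (gateLaw (exceptSecond (M + 2))) (partSwap M a b c) =
      ((2 * 2 ^ M * t - u) / (2 * 2 ^ M * ((2 * 2 ^ M) ^ 2 - 1))) • partSwap M false b false +
      ((2 * 2 ^ M * u - t) / (2 * 2 ^ M * ((2 * 2 ^ M) ^ 2 - 1))) • partSwap M true b true := by
  rw [partSwap, momentOp_gateLaw_swapOp _ ⟨0, zero_mem_exceptSecond⟩ _ (2 * 2 ^ M) t u,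
    threePart_exceptSecond, threePart_exceptSecond]
  · rfl
  · rw [prod_three]
    simp only [zero_mem_exceptSecond, one_notMem_exceptSecond, succ_mem_exceptSecond, if_true,
      if_false, Finset.prod_const, Finset.card_univ, Fintype.card_fin, one_mul]
  · rw [prod_three, ht]
    simp only [zero_mem_exceptSecond, one_notMem_exceptSecond, succ_mem_exceptSecond, if_true,
      if_false, one_mul]
    change _ = (bif a then 2 else 4) * ∏ j : Fin M, (bif c then (2 : ℂ) else 4)
    simp
  · rw [prod_three, hu]
    simp only [zero_mem_exceptSecond, one_notMem_exceptSecond, succ_mem_exceptSecond, if_true,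
      if_false, one_mul]
    change _ = (bif a then 4 else 2) * ∏ j : Fin M, (bif c then (4 : ℂ) else 2)
    simp

theorem gate_firstTwo (a b c : Bool) (t u : ℂ)
    (ht : t = (bif a then 2 else 4) * (bif b then 2 else 4))
    (hu : u = (bif a then 4 else 2) * (bif b then 4 else 2)) :
    momentOp 2 (gateLaw (firstTwo (M + 2))) (partSwap M a b c) =
      ((4 * t - u) / (4 * (4 ^ 2 - 1))) • partSwap M false false c +
      ((4 * u - t) / (4 * (4 ^ 2 - 1))) • partSwap M true true c := by
  rw [partSwap, momentOp_gateLaw_swapOp _ ⟨0, zero_mem_firstTwo⟩ _ 4 t u,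
    threePart_firstTwo, threePart_firstTwo]
  · rfl
  · rw [prod_three]
    simp only [zero_mem_firstTwo, one_mem_firstTwo, succ_notMem_firstTwo, if_true,
      if_false, Finset.prod_const_one]
    norm_num
  · rw [prod_three, ht]
    simp only [zero_mem_firstTwo, one_mem_firstTwo, succ_notMem_firstTwo, if_true,
      if_false, Finset.prod_const_one, mul_one]
    rfl
  · rw [prod_three, hu]
    simp only [zero_mem_firstTwo, one_mem_firstTwo, succ_notMem_firstTwo, if_true,
      if_false, Finset.prod_const_one, mul_one]
    rfl

/-- With q = 2^M and gate dimension 2q, the two traces are 4q and 2q² (in either order) when the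
labels disagree, and 4q² and 2q (in either order) when they agree. The last two identities express
that agreeing labels are fixed. -/
theorem weight_eqs :
    ((2 * 2 ^ M * (4 * 2 ^ M) - 2 * (2 ^ M) ^ 2) / (2 * 2 ^ M * ((2 * 2 ^ M) ^ 2 - 1)) : ℂ) =
      (smallWeight M : ℂ) ∧
    ((2 * 2 ^ M * (2 * (2 ^ M) ^ 2) - 4 * 2 ^ M) / (2 * 2 ^ M * ((2 * 2 ^ M) ^ 2 - 1)) : ℂ) =
      (largeWeight M : ℂ) ∧
    ((2 * 2 ^ M * (4 * (2 ^ M) ^ 2) - 2 * 2 ^ M) / (2 * 2 ^ M * ((2 * 2 ^ M) ^ 2 - 1)) : ℂ) = 1 ∧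
    ((2 * 2 ^ M * (2 * 2 ^ M) - 4 * (2 ^ M) ^ 2) / (2 * 2 ^ M * ((2 * 2 ^ M) ^ 2 - 1)) : ℂ) =
      0 := by
  have h1 : (2 : ℂ) ^ M ≠ 0 := pow_ne_zero _ two_ne_zero
  have h2 := dim_ne (M := M)
  have h3 : ((2 * 2 ^ M) ^ 2 - 1 : ℂ) = 4 * (2 ^ M) ^ 2 - 1 := by ring
  rw [h3]
  unfold smallWeight largeWeight
  push_cast
  refine ⟨?_, ?_, ?_, ?_⟩
  · field_simp; ring
  · field_simp; ring
  · rw [div_eq_one_iff_eq (mul_ne_zero (mul_ne_zero two_ne_zero h1) h2)]; ring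
  · field_simp; ring

theorem gate_exceptFirst_ft (a : Bool) :
    momentOp 2 (gateLaw (exceptFirst (M + 2))) (partSwap M a false true) =
      (smallWeight M : ℂ) • partSwap M a false false +
        (largeWeight M : ℂ) • partSwap M a true true := by
  rw [gate_exceptFirst a false true (4 * 2 ^ M) (2 * (2 ^ M) ^ 2) (by simp)
    (by simp [four_pow_eq]), weight_eqs.1, weight_eqs.2.1]

theorem gate_exceptFirst_tf (a : Bool) :
    momentOp 2 (gateLaw (exceptFirst (M + 2))) (partSwap M a true false) =
      (largeWeight M : ℂ) • partSwap M a false false +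
        (smallWeight M : ℂ) • partSwap M a true true := by
  rw [gate_exceptFirst a true false (2 * (2 ^ M) ^ 2) (4 * 2 ^ M) (by simp [four_pow_eq])
    (by simp), weight_eqs.1, weight_eqs.2.1]

theorem gate_exceptFirst_eq (a c : Bool) :
    momentOp 2 (gateLaw (exceptFirst (M + 2))) (partSwap M a c c) = partSwap M a c c := by
  cases c
  · rw [gate_exceptFirst a false false (4 * (2 ^ M) ^ 2) (2 * 2 ^ M) (by simp [four_pow_eq])
      (by simp), weight_eqs.2.2.1, weight_eqs.2.2.2, one_smul, zero_smul, add_zero]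
  · rw [gate_exceptFirst a true true (2 * 2 ^ M) (4 * (2 ^ M) ^ 2) (by simp)
      (by simp [four_pow_eq]), weight_eqs.2.2.1, weight_eqs.2.2.2, one_smul, zero_smul, zero_add]

theorem gate_exceptSecond_ft (b : Bool) :
    momentOp 2 (gateLaw (exceptSecond (M + 2))) (partSwap M false b true) =
      (smallWeight M : ℂ) • partSwap M false b false +
        (largeWeight M : ℂ) • partSwap M true b true := by
  rw [gate_exceptSecond false b true (4 * 2 ^ M) (2 * (2 ^ M) ^ 2) (by simp)
    (by simp [four_pow_eq]), weight_eqs.1, weight_eqs.2.1]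

theorem gate_exceptSecond_tf (b : Bool) :
    momentOp 2 (gateLaw (exceptSecond (M + 2))) (partSwap M true b false) =
      (largeWeight M : ℂ) • partSwap M false b false +
        (smallWeight M : ℂ) • partSwap M true b true := by
  rw [gate_exceptSecond true b false (2 * (2 ^ M) ^ 2) (4 * 2 ^ M) (by simp [four_pow_eq])
    (by simp), weight_eqs.1, weight_eqs.2.1]

theorem gate_exceptSecond_eq (b c : Bool) :
    momentOp 2 (gateLaw (exceptSecond (M + 2))) (partSwap M c b c) = partSwap M c b c := by
  cases c
  · rw [gate_exceptSecond false b false (4 * (2 ^ M) ^ 2) (2 * 2 ^ M) (by simp [four_pow_eq])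
      (by simp), weight_eqs.2.2.1, weight_eqs.2.2.2, one_smul, zero_smul, add_zero]
  · rw [gate_exceptSecond true b true (2 * 2 ^ M) (4 * (2 ^ M) ^ 2) (by simp)
      (by simp [four_pow_eq]), weight_eqs.2.2.1, weight_eqs.2.2.2, one_smul, zero_smul, zero_add]

/-- In dimension 4 both traces equal 8, so each outcome has weight (4 · 8 - 8)/60. Unlike
`smallWeight`, this does not decay with the number of sites. -/
theorem gate_firstTwo_ne (a c : Bool) :
    momentOp 2 (gateLaw (firstTwo (M + 2))) (partSwap M a (!a) c) =
      (2 / 5 : ℂ) • partSwap M false false c + (2 / 5 : ℂ) • partSwap M true true c := by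
  rw [gate_firstTwo a (!a) c 8 8 (by cases a <;> norm_num) (by cases a <;> norm_num)]
  norm_num

theorem gate_firstTwo_eq (a c : Bool) :
    momentOp 2 (gateLaw (firstTwo (M + 2))) (partSwap M a a c) = partSwap M a a c := by
  cases a
  · rw [gate_firstTwo false false c 16 4 (by norm_num) (by norm_num)]
    norm_num
  · rw [gate_firstTwo true true c 4 16 (by norm_num) (by norm_num)]
    norm_num

end Period


/-! ### Convergence rates of the two periods -/

section Spectrum

variable {M : ℕ}

/-- The operators that act as `w` on the first site and as a product of identities or of flips on
the other sites. -/
def firstSiteOp (M : ℕ) (w : (Fin 2 → Fin 2) → (Fin 2 → Fin 2) → ℂ) (c : Bool) :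
    Matrix (Fin 2 → Qubits (M + 2)) (Fin 2 → Qubits (M + 2)) ℂ :=
  Matrix.of fun x y => w (fun k => x k 0) (fun k => y k 0) *
    (siteFactor c (fun k => x k 1) (fun k => y k 1) *
      ∏ j : Fin M, siteFactor c (fun k => x k j.succ.succ) (fun k => y k j.succ.succ))

/-- The entry point for arbitrary operators: the gate averages everything except the first site,
whose matrix entries survive as unknown coefficients. -/
theorem momentOp_exceptFirst_eq
    (X : Matrix (Fin 2 → Qubits (M + 2)) (Fin 2 → Qubits (M + 2)) ℂ) :
    ∃ v w, momentOp 2 (gateLaw (exceptFirst (M + 2))) X =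
      firstSiteOp M v false + firstSiteOp M w true := by
  have : Nonempty {i : Fin (M + 2) // i ∈ exceptFirst (M + 2)} := ⟨⟨1, one_mem_exceptFirst⟩⟩
  -- The first site is the only one outside the gate, so its indices alone select the block.
  obtain ⟨B, hB⟩ : ∃ B : (Fin 2 → Fin 2) → (Fin 2 → Fin 2) →
      Matrix (Fin 2 → QubitsOn (exceptFirst (M + 2))) (Fin 2 → QubitsOn (exceptFirst (M + 2))) ℂ,
      ∀ x y, gateBlock (exceptFirst (M + 2)) X x y = B (fun k => x k 0) (fun k => y k 0) := by
    refine ⟨fun u v => blockAt (X.submatrix (splitPair _).symm (splitPair _).symm)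
      (fun k _ => u k) (fun k _ => v k), fun x y => ?_⟩
    have h : ∀ z : Fin 2 → Qubits (M + 2),
        (splitPair (exceptFirst (M + 2)) z).2 = fun k _ => z k 0 := by
      intro z
      funext k i
      have hi : (i : Fin (M + 2)) = 0 := by
        have := i.2
        simp only [exceptFirst, Finset.mem_filter, Finset.mem_univ, true_and, not_not] at this
        exact Fin.ext this
      change z k i = z k 0
      rw [hi]
    rw [gateBlock, h, h]
  refine ⟨fun u v => haarCoeffOne (B u v), fun u v => haarCoeffFlip (B u v), ?_⟩
  ext x y
  have hprod : ∀ c, ∏ i : {i : Fin (M + 2) // i ∈ exceptFirst (M + 2)},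
      siteFactor c (fun k => x k i) (fun k => y k i) =
      siteFactor c (fun k => x k 1) (fun k => y k 1) *
        ∏ j : Fin M, siteFactor c (fun k => x k j.succ.succ) (fun k => y k j.succ.succ) := by
    intro c
    rw [Finset.prod_coe_sort (exceptFirst (M + 2))
      fun i => siteFactor c (fun k => x k i) (fun k => y k i), prod_three]
    simp only [one_mem_exceptFirst, zero_notMem_exceptFirst, succ_mem_exceptFirst, if_true,
      if_false, one_mul]
  rw [momentOp_gateLaw_apply, hB, momentOp_two_haar]
  simp only [Matrix.add_apply, Matrix.smul_apply, smul_eq_mul, one_apply_eq_prod,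
    flipMat_apply_eq_prod, firstSiteOp, of_apply]
  rw [← hprod false, ← hprod true]
  rfl

theorem prod_subtype_notMem {N : ℕ} (S : Finset (Fin N)) (f : Fin N → ℂ) :
    ∏ i : {i : Fin N // i ∉ S}, f i = ∏ i ∈ Sᶜ, f i := by
  exact (Finset.prod_subtype Sᶜ (fun i => Finset.mem_compl) f).symm

/-- The gate averages the arbitrary factor on the first site, and the only site it misses already
carries a definite label. -/
theorem exceptSecond_firstSiteOp (w : (Fin 2 → Fin 2) → (Fin 2 → Fin 2) → ℂ) (c : Bool) :
    ∃ s t : ℂ, momentOp 2 (gateLaw (exceptSecond (M + 2))) (firstSiteOp M w c) =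
      s • partSwap M false c false + t • partSwap M true c true := by
  have h := momentOp_gateLaw_of_prod (exceptSecond (M + 2)) ⟨0, zero_mem_exceptSecond⟩
    (firstSiteOp M w c) (threePart M false c false) (Matrix.of fun x y =>
      w (fun k => x k ⟨0, zero_mem_exceptSecond⟩) (fun k => y k ⟨0, zero_mem_exceptSecond⟩) *
      ∏ j : Fin M, siteFactor c (fun k => x k ⟨j.succ.succ, succ_mem_exceptSecond j⟩)
        (fun k => y k ⟨j.succ.succ, succ_mem_exceptSecond j⟩)) ?_
  · rw [threePart_exceptSecond, threePart_exceptSecond] at h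
    exact ⟨_, _, h⟩
  · intro x y
    rw [prod_subtype_notMem (exceptSecond (M + 2)) fun i =>
      siteFactor (threePart M false c false i) (fun k => x k i) (fun k => y k i), prod_three]
    simp only [Finset.mem_compl, zero_mem_exceptSecond, one_notMem_exceptSecond,
      succ_mem_exceptSecond, not_true_eq_false, not_false_eq_true, if_true, if_false,
      Finset.prod_const_one, mul_one, one_mul, firstSiteOp, of_apply]
    change w _ _ * (siteFactor c _ _ * _) = w _ _ * _ * siteFactor c _ _
    ring

theorem firstTwo_firstSiteOp (w : (Fin 2 → Fin 2) → (Fin 2 → Fin 2) → ℂ) (c : Bool) :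
    ∃ s t : ℂ, momentOp 2 (gateLaw (firstTwo (M + 2))) (firstSiteOp M w c) =
      s • partSwap M false false c + t • partSwap M true true c := by
  have h := momentOp_gateLaw_of_prod (firstTwo (M + 2)) ⟨0, zero_mem_firstTwo⟩
    (firstSiteOp M w c) (threePart M false false c) (Matrix.of fun x y =>
      w (fun k => x k ⟨0, zero_mem_firstTwo⟩) (fun k => y k ⟨0, zero_mem_firstTwo⟩) *
      siteFactor c (fun k => x k ⟨1, one_mem_firstTwo⟩) (fun k => y k ⟨1, one_mem_firstTwo⟩)) ?_
  · rw [threePart_firstTwo, threePart_firstTwo] at h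
    exact ⟨_, _, h⟩
  · intro x y
    rw [prod_subtype_notMem (firstTwo (M + 2)) fun i =>
      siteFactor (threePart M false false c i) (fun k => x k i) (fun k => y k i), prod_three]
    simp only [Finset.mem_compl, zero_mem_firstTwo, one_mem_firstTwo,
      succ_notMem_firstTwo, not_true_eq_false, not_false_eq_true, if_true, if_false,
      one_mul, firstSiteOp, of_apply]
    change w _ _ * (siteFactor c _ _ * _) = w _ _ * siteFactor c _ _ *
      ∏ j : Fin M, siteFactor c _ _
    ring

/-- The span of the products of swaps on the three parts. -/
def partSpan (M : ℕ) : Submodule ℂ (Matrix (Fin 2 → Qubits (M + 2)) (Fin 2 → Qubits (M + 2)) ℂ) :=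
  Submodule.span ℂ (Set.range fun p : Bool × Bool × Bool => partSwap M p.1 p.2.1 p.2.2)

/-- The span of the products of swaps on the first site and on the other sites. -/
def twoPartSpan (M : ℕ) :
    Submodule ℂ (Matrix (Fin 2 → Qubits (M + 2)) (Fin 2 → Qubits (M + 2)) ℂ) :=
  Submodule.span ℂ (Set.range fun p : Bool × Bool => partSwap M p.1 p.2 p.2)

theorem partSwap_mem_partSpan (a b c : Bool) : partSwap M a b c ∈ partSpan M :=
  Submodule.subset_span ⟨(a, b, c), rfl⟩

theorem partSwap_mem_twoPartSpan (a c : Bool) : partSwap M a c c ∈ twoPartSpan M :=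
  Submodule.subset_span ⟨(a, c), rfl⟩

theorem exceptFirst_partSpan {X : Matrix (Fin 2 → Qubits (M + 2)) (Fin 2 → Qubits (M + 2)) ℂ}
    (hX : X ∈ partSpan M) :
    momentOp 2 (gateLaw (exceptFirst (M + 2))) X ∈ twoPartSpan M := by
  refine (Submodule.span_le (p := (twoPartSpan M).comap (momentOp 2 _))).mpr ?_ hX
  rintro _ ⟨⟨a, b, c⟩, rfl⟩
  change momentOp 2 (gateLaw (exceptFirst (M + 2))) (partSwap M a b c) ∈ twoPartSpan M
  rw [gate_exceptFirst a b c _ _ rfl rfl]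
  exact add_mem (Submodule.smul_mem _ _ (partSwap_mem_twoPartSpan _ _))
    (Submodule.smul_mem _ _ (partSwap_mem_twoPartSpan _ _))

theorem exceptSecond_partSpan {X : Matrix (Fin 2 → Qubits (M + 2)) (Fin 2 → Qubits (M + 2)) ℂ}
    (hX : X ∈ partSpan M) :
    momentOp 2 (gateLaw (exceptSecond (M + 2))) X ∈ partSpan M := by
  refine (Submodule.span_le (p := (partSpan M).comap (momentOp 2 _))).mpr ?_ hX
  rintro _ ⟨⟨a, b, c⟩, rfl⟩
  change momentOp 2 (gateLaw (exceptSecond (M + 2))) (partSwap M a b c) ∈ partSpan M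
  rw [gate_exceptSecond a b c _ _ rfl rfl]
  exact add_mem (Submodule.smul_mem _ _ (partSwap_mem_partSpan _ _ _))
    (Submodule.smul_mem _ _ (partSwap_mem_partSpan _ _ _))

theorem firstTwo_partSpan {X : Matrix (Fin 2 → Qubits (M + 2)) (Fin 2 → Qubits (M + 2)) ℂ}
    (hX : X ∈ partSpan M) :
    momentOp 2 (gateLaw (firstTwo (M + 2))) X ∈ partSpan M := by
  refine (Submodule.span_le (p := (partSpan M).comap (momentOp 2 _))).mpr ?_ hX
  rintro _ ⟨⟨a, b, c⟩, rfl⟩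
  change momentOp 2 (gateLaw (firstTwo (M + 2))) (partSwap M a b c) ∈ partSpan M
  rw [gate_firstTwo a b c _ _ rfl rfl]
  exact add_mem (Submodule.smul_mem _ _ (partSwap_mem_partSpan _ _ _))
    (Submodule.smul_mem _ _ (partSwap_mem_partSpan _ _ _))

theorem momentOp_periodC' (N : ℕ) (X : Matrix (Fin 2 → Qubits N) (Fin 2 → Qubits N) ℂ) :
    momentOp 2 (circuitLaw (periodC' N)) X =
      momentOp 2 (gateLaw (exceptFirst N)) (momentOp 2 (gateLaw (exceptSecond N))
        (momentOp 2 (gateLaw (exceptFirst N)) X)) := by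
  rw [periodC', momentOp_circuitLaw_cons, momentOp_circuitLaw_cons, momentOp_circuitLaw_cons,
    momentOp_circuitLaw_nil]
  rfl

theorem momentOp_periodC (N : ℕ) (X : Matrix (Fin 2 → Qubits N) (Fin 2 → Qubits N) ℂ) :
    momentOp 2 (circuitLaw (periodC N)) X =
      momentOp 2 (gateLaw (exceptFirst N)) (momentOp 2 (gateLaw (firstTwo N))
        (momentOp 2 (gateLaw (exceptSecond N)) (momentOp 2 (gateLaw (firstTwo N))
          (momentOp 2 (gateLaw (exceptFirst N)) X)))) := by
  rw [periodC, momentOp_circuitLaw_cons, momentOp_circuitLaw_cons, momentOp_circuitLaw_cons,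
    momentOp_circuitLaw_cons, momentOp_circuitLaw_cons, momentOp_circuitLaw_nil]
  rfl

/-- The first gate and the next gate containing the first site together average every site. The last
gate gives the second and the remaining sites a common label, which is why the period ends with it.
-/
theorem momentOp_periodC'_mem
    (X : Matrix (Fin 2 → Qubits (M + 2)) (Fin 2 → Qubits (M + 2)) ℂ) :
    momentOp 2 (circuitLaw (periodC' (M + 2))) X ∈ twoPartSpan M := by
  rw [momentOp_periodC']
  apply exceptFirst_partSpan
  obtain ⟨v, w, h⟩ := momentOp_exceptFirst_eq X
  obtain ⟨s, t, h1⟩ := exceptSecond_firstSiteOp (M := M) v false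
  obtain ⟨s', t', h2⟩ := exceptSecond_firstSiteOp (M := M) w true
  rw [h, map_add, h1, h2]
  exact add_mem (add_mem (Submodule.smul_mem _ _ (partSwap_mem_partSpan _ _ _))
    (Submodule.smul_mem _ _ (partSwap_mem_partSpan _ _ _)))
    (add_mem (Submodule.smul_mem _ _ (partSwap_mem_partSpan _ _ _))
    (Submodule.smul_mem _ _ (partSwap_mem_partSpan _ _ _)))

theorem momentOp_periodC_mem
    (X : Matrix (Fin 2 → Qubits (M + 2)) (Fin 2 → Qubits (M + 2)) ℂ) :
    momentOp 2 (circuitLaw (periodC (M + 2))) X ∈ twoPartSpan M := by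
  rw [momentOp_periodC]
  apply exceptFirst_partSpan
  apply firstTwo_partSpan
  apply exceptSecond_partSpan
  obtain ⟨v, w, h⟩ := momentOp_exceptFirst_eq X
  obtain ⟨s, t, h1⟩ := firstTwo_firstSiteOp (M := M) v false
  obtain ⟨s', t', h2⟩ := firstTwo_firstSiteOp (M := M) w true
  rw [h, map_add, h1, h2]
  exact add_mem (add_mem (Submodule.smul_mem _ _ (partSwap_mem_partSpan _ _ _))
    (Submodule.smul_mem _ _ (partSwap_mem_partSpan _ _ _)))
    (add_mem (Submodule.smul_mem _ _ (partSwap_mem_partSpan _ _ _))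
    (Submodule.smul_mem _ _ (partSwap_mem_partSpan _ _ _)))

/-- The eigenvalue of the censored period off the Haar moment. -/
noncomputable def rateC' (M : ℕ) : ℝ := smallWeight M ^ 2

/-- The eigenvalue of the five-gate period off the Haar moment. -/
noncomputable def rateC (M : ℕ) : ℝ := (2 / 5 * largeWeight M) ^ 2

/-- With F and T for `false` and `true`, the only returning path from FTT is FTT → FTF → FTT, with
`smallWeight` at both steps; all other branches end in a constant pattern. The case TFF is its
mirror image. -/
theorem momentOp_periodC'_eq (a : Bool) :
    ∃ s t : ℂ, momentOp 2 (circuitLaw (periodC' (M + 2))) (partSwap M a (!a) (!a)) =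
      (rateC' M : ℂ) • partSwap M a (!a) (!a) +
        (s • partSwap M false false false + t • partSwap M true true true) := by
  simp only [momentOp_periodC']
  cases a
  · refine ⟨smallWeight M * largeWeight M, largeWeight M, ?_⟩
    simp only [Bool.not_false]
    rw [gate_exceptFirst_eq, gate_exceptSecond_ft, map_add, map_smul, map_smul,
      gate_exceptFirst_tf, gate_exceptFirst_eq, rateC']
    push_cast
    module
  · refine ⟨largeWeight M, smallWeight M * largeWeight M, ?_⟩
    simp only [Bool.not_true]
    rw [gate_exceptFirst_eq, gate_exceptSecond_tf, map_add, map_smul, map_smul,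
      gate_exceptFirst_ft, gate_exceptFirst_eq, rateC']
    push_cast
    module

/-- The only returning path from FTT is FTT → FFT → TFT → FFT → FTT, with weights 2/5,
`largeWeight`, 2/5, `largeWeight`; all other branches end in a constant pattern. The case TFF is its
mirror image. -/
theorem momentOp_periodC_eq (a : Bool) :
    ∃ s t : ℂ, momentOp 2 (circuitLaw (periodC (M + 2))) (partSwap M a (!a) (!a)) =
      (rateC M : ℂ) • partSwap M a (!a) (!a) +
        (s • partSwap M false false false + t • partSwap M true true true) := by
  have f1 := gate_firstTwo_ne (M := M) false
  have f2 := gate_firstTwo_ne (M := M) true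
  simp only [Bool.not_false, Bool.not_true] at f1 f2
  simp only [momentOp_periodC]
  cases a
  · refine ⟨2 / 5 * smallWeight M + 4 / 25 * smallWeight M * largeWeight M,
      2 / 5 + 4 / 25 * largeWeight M, ?_⟩
    simp only [Bool.not_false, gate_exceptFirst_eq, f1, f2, map_add, map_smul,
      gate_exceptSecond_ft, gate_exceptSecond_eq, gate_firstTwo_eq, gate_exceptFirst_ft, rateC]
    push_cast
    module
  · refine ⟨2 / 5 + 4 / 25 * largeWeight M,
      2 / 5 * smallWeight M + 4 / 25 * smallWeight M * largeWeight M, ?_⟩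
    simp only [Bool.not_true, gate_exceptFirst_eq, f1, f2, map_add, map_smul,
      gate_exceptSecond_tf, gate_exceptSecond_eq, gate_firstTwo_eq, gate_exceptFirst_tf, rateC]
    push_cast
    module

instance instNontrivialQubits : Nontrivial (Qubits (M + 2)) :=
  inferInstanceAs (Nontrivial (Fin (M + 2) → Fin 2))

theorem momentOp_of_commute {n : Type} [Fintype n] [DecidableEq n] (t : ℕ)
    (ν : Measure (unitaryGroup n ℂ)) [IsProbabilityMeasure ν]
    (B : Matrix (Fin t → n) (Fin t → n) ℂ)
    (hB : ∀ U : unitaryGroup n ℂ, B * tensorPow t U.1 = tensorPow t U.1 * B) :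
    momentOp t ν B = B := by
  ext x y
  change ∫ U : unitaryGroup n ℂ, (tensorPow t U.1 * B * (tensorPow t U.1)ᴴ) x y ∂ν = B x y
  simp only [← hB, Matrix.mul_assoc, tensorPow_unitary, Matrix.mul_one]
  simp

theorem partSwap_const_commute (a : Bool) (U : unitaryGroup (Qubits (M + 2)) ℂ) :
    partSwap M a a a * tensorPow 2 U.1 = tensorPow 2 U.1 * partSwap M a a a := by
  have h : ∀ (b : Bool) (x y : Fin 2 → Qubits (M + 2)), partSwap M b b b x y =
      ∏ i, siteFactor b (fun k => x k i) (fun k => y k i) := by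
    intro b x y
    rw [partSwap, swapOp, of_apply]
    refine Finset.prod_congr rfl fun i _ => ?_
    have : threePart M b b b i = b :=
      Fin.cases rfl (fun i => Fin.cases rfl (fun _ => rfl) i) i
    rw [this]
  cases a
  · have h1 : partSwap M false false false = 1 := by
      ext x y
      rw [h, one_apply_eq_prod]
    rw [h1, Matrix.one_mul, Matrix.mul_one]
  · have h1 : partSwap M true true true = flipMat _ := by
      ext x y
      rw [h, flipMat_apply_eq_prod]
    rw [h1, flipMat_mul_tensorPow]

/-- Constant patterns are fixed by both moments, and the other two are eigenvectors modulo them with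
the same `r`. The values of the correction terms `s`, `t` are not needed, since Haar absorption
determines their sum. -/
theorem momentOp_sub_haar_of_mem_twoPartSpan (ν : Measure (unitaryGroup (Qubits (M + 2)) ℂ))
    [IsProbabilityMeasure ν] (r : ℂ)
    (h : ∀ a : Bool, ∃ s t : ℂ, momentOp 2 ν (partSwap M a (!a) (!a)) =
      r • partSwap M a (!a) (!a) +
        (s • partSwap M false false false + t • partSwap M true true true))
    {X : Matrix (Fin 2 → Qubits (M + 2)) (Fin 2 → Qubits (M + 2)) ℂ} (hX : X ∈ twoPartSpan M) :
    momentOp 2 ν X - momentOp 2 (haarUnitary _) X = r • (X - momentOp 2 (haarUnitary _) X) := by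
  have hfix : ∀ (a : Bool) (μ : Measure (unitaryGroup (Qubits (M + 2)) ℂ))
      [IsProbabilityMeasure μ], momentOp 2 μ (partSwap M a a a) = partSwap M a a a :=
    fun a μ _ => momentOp_of_commute 2 μ _ (partSwap_const_commute a)
  refine (Submodule.span_le (p := LinearMap.eqLocus (momentOp 2 ν - momentOp 2 (haarUnitary _))
    (r • (LinearMap.id - momentOp 2 (haarUnitary _))))).mpr ?_ hX
  rintro _ ⟨⟨a, c⟩, rfl⟩
  change momentOp 2 ν (partSwap M a c c) - momentOp 2 (haarUnitary _) (partSwap M a c c) =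
    r • (partSwap M a c c - momentOp 2 (haarUnitary _) (partSwap M a c c))
  by_cases hc : c = a
  · rw [hc, hfix, hfix, sub_self, smul_zero]
  · obtain rfl : c = !a := by revert hc; cases a <;> cases c <;> simp
    obtain ⟨s, t, h⟩ := h a
    -- Applying the Haar moment H to the eigenvector relation for a pattern b shows that the
    -- correction equals (1 - r) H b.
    have h2 := LinearMap.congr_fun (momentOp_haar_momentOp ν) (partSwap M a (!a) (!a))
    rw [LinearMap.comp_apply, h, map_add, map_smul, map_add, map_smul, map_smul, hfix, hfix] at h2
    conv_lhs => rw [h, ← h2]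
    module

/-- If the range of a moment operator lies in the span above, its powers approach the Haar moment
geometrically. -/
theorem momentOp_repeated_sub_haar (A : Architecture (M + 2)) (r : ℂ)
    (h : ∀ a : Bool, ∃ s t : ℂ, momentOp 2 (circuitLaw A) (partSwap M a (!a) (!a)) =
      r • partSwap M a (!a) (!a) +
        (s • partSwap M false false false + t • partSwap M true true true))
    (hA : ∀ X, momentOp 2 (circuitLaw A) X ∈ twoPartSpan M) (d : ℕ) :
    momentOp 2 (circuitLaw (A.repeated (d + 1))) - momentOp 2 (haarUnitary _) =
      r ^ d • (momentOp 2 (circuitLaw A) - momentOp 2 (haarUnitary _)) := by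
  have hP := momentOp_haar_momentOp (circuitLaw A)
  -- One application brings any X into the span where the eigenvalue relation holds. This costs one
  -- period, hence the exponent `d` for `d + 1` repetitions.
  have hT : (momentOp 2 (circuitLaw A) - momentOp 2 (haarUnitary _)) ∘ₗ momentOp 2 (circuitLaw A) =
      r • (momentOp 2 (circuitLaw A) - momentOp 2 (haarUnitary _)) := by
    ext1 X
    have h1 := momentOp_sub_haar_of_mem_twoPartSpan (circuitLaw A) r h (hA X)
    have h2 := LinearMap.congr_fun hP X
    rw [LinearMap.comp_apply] at h2
    rw [LinearMap.comp_apply, LinearMap.sub_apply, h1, h2]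
    rfl
  induction d with
  | zero =>
    rw [momentOp_circuitLaw_repeated_succ, pow_zero, one_smul]
    change momentOp 2 (circuitLaw []) ∘ₗ _ - _ = _
    rw [momentOp_circuitLaw_nil, LinearMap.id_comp]
  | succ d ih =>
    rw [momentOp_circuitLaw_repeated_succ]
    conv_lhs => rw [← hP]
    rw [← LinearMap.sub_comp, ih, LinearMap.smul_comp, hT, smul_smul, pow_succ]

theorem periodC'_repeated_sub_haar (d : ℕ) :
    momentOp 2 (circuitLaw ((periodC' (M + 2)).repeated (d + 1))) - momentOp 2 (haarUnitary _) =
      ((rateC' M ^ d : ℝ) : ℂ) •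
        (momentOp 2 (circuitLaw (periodC' (M + 2))) - momentOp 2 (haarUnitary _)) := by
  rw [momentOp_repeated_sub_haar _ (rateC' M : ℂ) momentOp_periodC'_eq
    momentOp_periodC'_mem, Complex.ofReal_pow]

theorem periodC_repeated_sub_haar (d : ℕ) :
    momentOp 2 (circuitLaw ((periodC (M + 2)).repeated (d + 1))) - momentOp 2 (haarUnitary _) =
      ((rateC M ^ d : ℝ) : ℂ) •
        (momentOp 2 (circuitLaw (periodC (M + 2))) - momentOp 2 (haarUnitary _)) := by
  rw [momentOp_repeated_sub_haar _ (rateC M : ℂ) momentOp_periodC_eq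
    momentOp_periodC_mem, Complex.ofReal_pow]

theorem rateC'_pos : 0 < rateC' M := by
  have h : (1 : ℝ) ≤ 2 ^ M := one_le_pow₀ (by norm_num)
  have h2 : 0 < smallWeight M := div_pos (by positivity) (by nlinarith)
  exact pow_pos h2 2

/-- With q = 2^M the claim reduces to 15q < 4q² - 4. At q = 4 there is equality, so q = 8 is the
first admissible value. -/
theorem rateC'_lt_rateC (hM : 3 ≤ M) : rateC' M < rateC M := by
  have h : (8 : ℝ) ≤ 2 ^ M :=
    le_trans (by norm_num) (pow_le_pow_right₀ (by norm_num : (1 : ℝ) ≤ 2) hM)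
  have h0 : 0 < smallWeight M := div_pos (by positivity) (by nlinarith)
  refine pow_lt_pow_left₀ ?_ h0.le two_ne_zero
  rw [smallWeight, largeWeight, ← mul_div_assoc]
  refine div_lt_div_of_pos_right ?_ (by nlinarith)
  nlinarith

/-- The Haar moment does not fix the exchange of the copies of all sites but the first. -/
theorem haar_partSwap_ne :
    momentOp 2 (haarUnitary _) (partSwap M false true true) ≠ partSwap M false true true := by
  intro h
  rw [momentOp_two_haar] at h
  -- The row has copies 0…0 and 1…1; the column exchanges them except at the first site. The
  -- identity and the flip both vanish at this entry, the partial swap does not.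
  have h1 := congrFun (congrFun h ![fun _ => 0, fun _ => 1])
    ![fun i => if i = 0 then 0 else 1, fun i => if i = 0 then 1 else 0]
  have e1 : (1 : Matrix (Fin 2 → Qubits (M + 2)) (Fin 2 → Qubits (M + 2)) ℂ)
      ![fun _ => 0, fun _ => 1]
      ![fun i => if i = 0 then 0 else 1, fun i => if i = 0 then 1 else 0] = 0 := by
    refine Matrix.one_apply_ne fun h => ?_
    simpa using congrFun (congrFun h 0) 1
  have e2 : flipMat (Qubits (M + 2)) ![fun _ => 0, fun _ => 1]
      ![fun i => if i = 0 then 0 else 1, fun i => if i = 0 then 1 else 0] = 0 := by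
    refine if_neg fun h => ?_
    simpa using congrFun h.1 0
  have e3 : partSwap M false true true ![fun _ => 0, fun _ => 1]
      ![fun i => if i = 0 then 0 else 1, fun i => if i = 0 then 1 else 0] = 1 := by
    rw [partSwap, swapOp, of_apply]
    refine Finset.prod_eq_one fun i _ => ?_
    refine Fin.cases ?_ (fun i => ?_) i
    · simp [threePart, siteFactor]
    · have : threePart M false true true i.succ = true :=
        Fin.cases rfl (fun _ => rfl) i
      rw [this]
      simp [siteFactor]
  rw [Matrix.add_apply, Matrix.smul_apply, Matrix.smul_apply, e1, e2, e3] at h1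
  simp at h1

theorem periodC_sub_haar_partSwap_ne (hM : 3 ≤ M) :
    (momentOp 2 (circuitLaw (periodC (M + 2))) - momentOp 2 (haarUnitary (Qubits (M + 2))))
      (partSwap M false true true) ≠ 0 := by
  rw [LinearMap.sub_apply, momentOp_sub_haar_of_mem_twoPartSpan _ (rateC M : ℂ)
    momentOp_periodC_eq (partSwap_mem_twoPartSpan false true)]
  have h : rateC M ≠ 0 := (rateC'_pos.trans (rateC'_lt_rateC hM)).ne'
  exact smul_ne_zero (by exact_mod_cast h) (sub_ne_zero.mpr (Ne.symm haar_partSwap_ne))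

end Spectrum


/-! ### Trace norm and its duality with the operator norm -/

section TraceNorm

open scoped Matrix.Norms.L2Operator

variable {l : Type} [Fintype l] [DecidableEq l]

/-- A form of the singular value decomposition. -/
theorem exists_singular_values (X : Matrix l l ℂ) :
    ∃ (U V : Matrix l l ℂ) (σ : l → ℝ), ‖U‖ ≤ 1 ∧ ‖V‖ ≤ 1 ∧ (∀ i, 0 ≤ σ i) ∧
      X = U * diagonal (fun i => (σ i : ℂ)) * Vᴴ ∧
      Uᴴ * X * V = diagonal (fun i => (σ i : ℂ)) ∧ traceNorm X = ∑ i, σ i := by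
  obtain ⟨hH, hH'⟩ : ∃ h, h = isHermitian_conjTranspose_mul_self X := ⟨_, rfl⟩
  obtain ⟨V, hV⟩ : ∃ V : Matrix l l ℂ, V = hH.eigenvectorUnitary.1 := ⟨_, rfl⟩
  have hVV : Vᴴ * V = 1 := by
    rw [hV]; exact mem_unitaryGroup_iff'.mp hH.eigenvectorUnitary.2
  have hVV' : V * Vᴴ = 1 := by
    rw [hV]; exact mem_unitaryGroup_iff.mp hH.eigenvectorUnitary.2
  have hdiag : Vᴴ * (Xᴴ * X) * V = diagonal fun i => ((hH.eigenvalues i : ℝ) : ℂ) := by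
    rw [hV]
    have := hH.conjStarAlgAut_star_eigenvectorUnitary
    rw [Unitary.conjStarAlgAut_star_apply] at this
    exact this
  have hnn : ∀ i, 0 ≤ hH.eigenvalues i := (posSemidef_conjTranspose_mul_self X).eigenvalues_nonneg
  obtain ⟨σ, hσ⟩ : ∃ σ : l → ℝ, σ = fun i => √(hH.eigenvalues i) := ⟨_, rfl⟩
  have hσ0 : ∀ i, 0 ≤ σ i := fun i => by rw [hσ]; exact Real.sqrt_nonneg _
  have hσ2 : ∀ i, (σ i : ℂ) * σ i = (hH.eigenvalues i : ℂ) := fun i => by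
    rw [hσ, ← Complex.ofReal_mul, Real.mul_self_sqrt (hnn i)]
  have hYY : (X * V)ᴴ * (X * V) = diagonal fun i => (σ i : ℂ) * σ i := by
    simp only [hσ2]
    rw [← hdiag, conjTranspose_mul]
    simp only [Matrix.mul_assoc]
  -- Rescaling the orthogonal columns of X V gives the left factor. Since 0⁻¹ = 0, zero columns stay
  -- zero: the result need not be unitary, but it is a contraction, which suffices.
  obtain ⟨D, hD⟩ : ∃ D : Matrix l l ℂ, D = diagonal fun i => (σ i : ℂ)⁻¹ := ⟨_, rfl⟩
  have hDD : Dᴴ = D := by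
    rw [hD, diagonal_conjTranspose]
    congr 1
    funext i
    simp
  have hU : ‖X * V * D‖ ≤ 1 := by
    have h : (X * V * D)ᴴ * (X * V * D) =
        diagonal fun i => (σ i : ℂ)⁻¹ * ((σ i : ℂ) * σ i) * (σ i : ℂ)⁻¹ := by
      rw [conjTranspose_mul, Matrix.mul_assoc, ← Matrix.mul_assoc (X * V)ᴴ, hYY, hDD, hD,
        diagonal_mul_diagonal, diagonal_mul_diagonal]
      simp only [mul_assoc]
    have h2 := l2_opNorm_conjTranspose_mul_self (X * V * D)
    have h3 : ‖(X * V * D)ᴴ * (X * V * D)‖ ≤ 1 := by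
      rw [h, l2_opNorm_diagonal, pi_norm_le_iff_of_nonneg zero_le_one]
      intro i
      by_cases h0 : (σ i : ℂ) = 0
      · simp [h0]
      · rw [← mul_assoc, inv_mul_cancel₀ h0, one_mul, mul_inv_cancel₀ h0, norm_one]
    nlinarith [norm_nonneg (X * V * D)]
  have hV1 : ‖V‖ ≤ 1 := by
    have h2 := l2_opNorm_conjTranspose_mul_self V
    have h3 : ‖(1 : Matrix l l ℂ)‖ ≤ 1 := by
      rw [← diagonal_one, l2_opNorm_diagonal, pi_norm_le_iff_of_nonneg zero_le_one]
      intro i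
      simp
    rw [hVV] at h2
    nlinarith [norm_nonneg V]
  have hXV : X * V = X * V * D * diagonal fun i => (σ i : ℂ) := by
    rw [Matrix.mul_assoc (X * V), hD, diagonal_mul_diagonal]
    ext i j
    rw [mul_diagonal]
    by_cases h0 : σ j = 0
    · have h1 : ((X * V)ᴴ * (X * V)) j j = 0 := by
        rw [hYY, diagonal_apply_eq, h0]
        simp
      rw [Matrix.mul_apply] at h1
      simp only [conjTranspose_apply] at h1
      have h2 : ∀ k, star ((X * V) k j) * (X * V) k j = ((‖(X * V) k j‖ ^ 2 : ℝ) : ℂ) := by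
        intro k
        rw [Complex.star_def, Complex.conj_mul']
        push_cast
        rfl
      simp only [h2] at h1
      rw [← Complex.ofReal_sum, Complex.ofReal_eq_zero,
        Finset.sum_eq_zero_iff_of_nonneg fun _ _ => by positivity] at h1
      have h3 := h1 i (Finset.mem_univ i)
      have h4 : (X * V) i j = 0 := by simpa using h3
      rw [h4, zero_mul]
    · rw [inv_mul_cancel₀ (by exact_mod_cast h0), mul_one]
  refine ⟨X * V * D, V, σ, hU, hV1, hσ0, ?_, ?_, ?_⟩
  · rw [← hXV, Matrix.mul_assoc, hVV', Matrix.mul_one]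
  · rw [conjTranspose_mul, hDD, Matrix.mul_assoc, Matrix.mul_assoc, hYY, hD, diagonal_mul_diagonal]
    congr 1
    funext i
    by_cases h0 : (σ i : ℂ) = 0
    · simp [h0]
    · rw [← mul_assoc, inv_mul_cancel₀ h0, one_mul]
  · rw [hσ, hH', traceNorm]

theorem norm_entry_le (A : Matrix l l ℂ) (i j : l) : ‖A i j‖ ≤ ‖A‖ := by
  have h := l2_opNorm_mulVec A (EuclideanSpace.single j 1)
  rw [PiLp.norm_single, norm_one, mul_one] at h
  refine le_trans ?_ h
  have h2 := PiLp.norm_apply_le (WithLp.toLp 2 (A *ᵥ (EuclideanSpace.single j (1 : ℂ)).ofLp)) i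
  simpa using h2

theorem traceNorm_nonneg (X : Matrix l l ℂ) : 0 ≤ traceNorm X :=
  Finset.sum_nonneg fun _ _ => Real.sqrt_nonneg _

theorem norm_trace_mul_le (W X : Matrix l l ℂ) : ‖(W * X).trace‖ ≤ ‖W‖ * traceNorm X := by
  obtain ⟨U, V, σ, hU, hV, hσ, hX, -, hs⟩ := exists_singular_values X
  have h1 : (W * X).trace = ∑ i, (Vᴴ * W * U) i i * σ i := by
    rw [hX, ← Matrix.mul_assoc, Matrix.trace_mul_comm, ← Matrix.mul_assoc, ← Matrix.mul_assoc]
    simp only [Matrix.trace, diag_apply, mul_diagonal]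
  have h2 : ‖Vᴴ * W * U‖ ≤ ‖W‖ := by
    have hV' : ‖Vᴴ‖ ≤ 1 := by rwa [l2_opNorm_conjTranspose]
    calc ‖Vᴴ * W * U‖ ≤ ‖Vᴴ‖ * ‖W‖ * ‖U‖ :=
          (l2_opNorm_mul _ _).trans (mul_le_mul_of_nonneg_right (l2_opNorm_mul _ _) (norm_nonneg _))
      _ ≤ 1 * ‖W‖ * 1 := by gcongr
      _ = ‖W‖ := by ring
  rw [h1, hs, Finset.mul_sum]
  refine (norm_sum_le _ _).trans (Finset.sum_le_sum fun i _ => ?_)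
  rw [norm_mul, Complex.norm_real, Real.norm_of_nonneg (hσ i)]
  exact mul_le_mul_of_nonneg_right ((norm_entry_le _ i i).trans h2) (hσ i)

theorem exists_trace_mul_eq (X : Matrix l l ℂ) :
    ∃ W : Matrix l l ℂ, ‖W‖ ≤ 1 ∧ (W * X).trace = (traceNorm X : ℂ) := by
  obtain ⟨U, V, σ, hU, hV, hσ, -, hX, hs⟩ := exists_singular_values X
  refine ⟨V * Uᴴ, ?_, ?_⟩
  · have hU' : ‖Uᴴ‖ ≤ 1 := by rwa [l2_opNorm_conjTranspose]
    exact (l2_opNorm_mul _ _).trans (mul_le_one₀ hV (norm_nonneg _) hU')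
  · rw [Matrix.mul_assoc, Matrix.trace_mul_comm, hX, trace_diagonal, hs, Complex.ofReal_sum]

/-- The trace norm is a maximum of |tr(W X)| over contractions W. The norm inequalities below follow
from this form without further use of singular values. -/
theorem traceNorm_le_of_forall {X : Matrix l l ℂ} {r : ℝ}
    (h : ∀ W : Matrix l l ℂ, ‖W‖ ≤ 1 → ‖(W * X).trace‖ ≤ r) : traceNorm X ≤ r := by
  obtain ⟨W, hW, hX⟩ := exists_trace_mul_eq X
  have := h W hW
  rwa [hX, Complex.norm_real, Real.norm_of_nonneg (traceNorm_nonneg X)] at this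

theorem norm_trace_mul_le_traceNorm {W : Matrix l l ℂ} (hW : ‖W‖ ≤ 1) (X : Matrix l l ℂ) :
    ‖(W * X).trace‖ ≤ traceNorm X :=
  (norm_trace_mul_le W X).trans (mul_le_of_le_one_left (traceNorm_nonneg X) hW)

theorem traceNorm_sum_le {ι : Type} (s : Finset ι) (X : ι → Matrix l l ℂ) :
    traceNorm (∑ i ∈ s, X i) ≤ ∑ i ∈ s, traceNorm (X i) := by
  refine traceNorm_le_of_forall fun W hW => ?_
  rw [Matrix.mul_sum, Matrix.trace_sum]
  exact (norm_sum_le _ _).trans (Finset.sum_le_sum fun i _ => norm_trace_mul_le_traceNorm hW _)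

theorem traceNorm_smul_le (c : ℂ) (X : Matrix l l ℂ) :
    traceNorm (c • X) ≤ ‖c‖ * traceNorm X := by
  refine traceNorm_le_of_forall fun W hW => ?_
  rw [Matrix.mul_smul, Matrix.trace_smul, norm_smul]
  exact mul_le_mul_of_nonneg_left (norm_trace_mul_le_traceNorm hW _) (norm_nonneg c)

theorem traceNorm_smul (c : ℂ) (X : Matrix l l ℂ) : traceNorm (c • X) = ‖c‖ * traceNorm X := by
  refine le_antisymm (traceNorm_smul_le c X) ?_
  by_cases hc : c = 0
  · rw [hc, norm_zero, zero_mul]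
    exact traceNorm_nonneg _
  · have h := traceNorm_smul_le c⁻¹ (c • X)
    rw [smul_smul, inv_mul_cancel₀ hc, one_smul, norm_inv] at h
    have hc' : 0 < ‖c‖ := norm_pos_iff.mpr hc
    calc ‖c‖ * traceNorm X ≤ ‖c‖ * (‖c‖⁻¹ * traceNorm (c • X)) := by gcongr
      _ = traceNorm (c • X) := by field_simp

theorem traceNorm_mul_mul_le {A B : Matrix l l ℂ} (hA : ‖A‖ ≤ 1) (hB : ‖B‖ ≤ 1)
    (X : Matrix l l ℂ) : traceNorm (A * X * B) ≤ traceNorm X := by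
  refine traceNorm_le_of_forall fun W hW => ?_
  have h : (W * (A * X * B)).trace = (B * W * A * X).trace := by
    rw [← Matrix.mul_assoc, Matrix.trace_mul_comm]
    simp only [Matrix.mul_assoc]
  rw [h]
  refine norm_trace_mul_le_traceNorm ?_ X
  exact (l2_opNorm_mul _ _).trans (mul_le_one₀ ((l2_opNorm_mul _ _).trans
    (mul_le_one₀ hB (norm_nonneg _) hW)) (norm_nonneg _) hA)

theorem traceNorm_pos {X : Matrix l l ℂ} (hX : X ≠ 0) : 0 < traceNorm X := by
  refine lt_of_le_of_ne (traceNorm_nonneg X) fun h => hX ?_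
  ext i j
  have h1 := norm_trace_mul_le (single j i 1) X
  rw [← h, mul_zero, Matrix.trace_single_mul, norm_le_zero_iff] at h1
  simpa using h1

/-- A partial isometry; the bound does not depend on the ancilla dimension. -/
theorem norm_single_kronecker_one_le {m : Type} [Fintype m] [DecidableEq m] (k : ℕ) (p i : m) :
    ‖(single p i (1 : ℂ)) ⊗ₖ (1 : Matrix (Fin k) (Fin k) ℂ)‖ ≤ 1 := by
  have h := l2_opNorm_conjTranspose_mul_self
    ((single p i (1 : ℂ)) ⊗ₖ (1 : Matrix (Fin k) (Fin k) ℂ))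
  have h2 : ((single p i (1 : ℂ)) ⊗ₖ (1 : Matrix (Fin k) (Fin k) ℂ))ᴴ *
      ((single p i (1 : ℂ)) ⊗ₖ (1 : Matrix (Fin k) (Fin k) ℂ)) =
      diagonal fun a : m × Fin k => if a.1 = i then 1 else 0 := by
    rw [conjTranspose_kronecker, ← mul_kronecker_mul, conjTranspose_single, star_one,
      single_mul_single_same, conjTranspose_one, Matrix.one_mul, mul_one]
    ext a b
    rw [kroneckerMap_apply, single_apply, Matrix.one_apply, diagonal_apply]
    by_cases h1 : a.1 = b.1 <;> by_cases h2 : a.2 = b.2 <;> by_cases h3 : a.1 = i <;>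
      simp_all [Prod.ext_iff, eq_comm]
  have h3 : ‖(diagonal fun a : m × Fin k => if a.1 = i then (1 : ℂ) else 0)‖ ≤ 1 := by
    rw [l2_opNorm_diagonal, pi_norm_le_iff_of_nonneg zero_le_one]
    intro a
    split_ifs <;> simp
  rw [h2] at h
  nlinarith [norm_nonneg ((single p i (1 : ℂ)) ⊗ₖ (1 : Matrix (Fin k) (Fin k) ℂ))]

end TraceNorm

/-! ### Finiteness, homogeneity and positivity of the diamond norm -/

section DiamondNorm

variable {m : Type} [Fintype m] [DecidableEq m]

theorem ampliate_smul (k : ℕ) (c : ℂ) (Φ : Matrix m m ℂ →ₗ[ℂ] Matrix m m ℂ)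
    (X : Matrix (m × Fin k) (m × Fin k) ℂ) : ampliate k (c • Φ) X = c • ampliate k Φ X := rfl

/-- Φ is expanded into maps of the form X ↦ E X E' with matrix units. Neither the number of terms
nor the coefficients depend on `k`, so trace norm bounds become uniform over ancillas. -/
theorem ampliate_eq_sum (k : ℕ) (Φ : Matrix m m ℂ →ₗ[ℂ] Matrix m m ℂ)
    (X : Matrix (m × Fin k) (m × Fin k) ℂ) :
    ampliate k Φ X = ∑ x : (m × m) × m × m, Φ (single x.1.1 x.1.2 1) x.2.1 x.2.2 •
      ((single x.2.1 x.1.1 (1 : ℂ) ⊗ₖ (1 : Matrix (Fin k) (Fin k) ℂ)) * X *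
        (single x.1.2 x.2.2 (1 : ℂ) ⊗ₖ (1 : Matrix (Fin k) (Fin k) ℂ))) := by
  ext a b
  change Φ (blockAt X a.2 b.2) a.1 b.1 = _
  simp only [Matrix.sum_apply, Matrix.smul_apply, kronecker_one_conj_apply, smul_eq_mul]
  conv_lhs => rw [matrix_eq_sum_single (blockAt X a.2 b.2)]
  simp only [Fintype.sum_prod_type, map_sum, Matrix.sum_apply]
  refine Finset.sum_congr rfl fun i _ => Finset.sum_congr rfl fun j _ => ?_
  have h1 : single i j (blockAt X a.2 b.2 i j) = blockAt X a.2 b.2 i j • single i j (1 : ℂ) := by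
    rw [smul_single, smul_eq_mul, mul_one]
  have h2 : ∀ p q : m, (single p i (1 : ℂ) * blockAt X a.2 b.2 * single j q (1 : ℂ)) a.1 b.1 =
      if p = a.1 then if q = b.1 then blockAt X a.2 b.2 i j else 0 else 0 := by
    intro p q
    rw [single_mul_mul_single, single_apply, ite_and]
    simp
  simp only [h2, mul_ite, mul_zero, Finset.sum_ite_eq', Finset.mem_univ, if_true,
    Finset.sum_ite_irrel, Finset.sum_const_zero]
  rw [h1, map_smul, Matrix.smul_apply, smul_eq_mul, mul_comm]

theorem exists_traceNorm_ampliate_le (Φ : Matrix m m ℂ →ₗ[ℂ] Matrix m m ℂ) :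
    ∃ K : ℝ, 0 < K ∧ ∀ (k : ℕ) (X : Matrix (m × Fin k) (m × Fin k) ℂ),
      traceNorm (ampliate k Φ X) ≤ K * traceNorm X := by
  refine ⟨1 + ∑ x : (m × m) × m × m, ‖Φ (single x.1.1 x.1.2 1) x.2.1 x.2.2‖, by positivity,
    fun k X => ?_⟩
  rw [ampliate_eq_sum, add_mul, one_mul, Finset.sum_mul]
  refine (traceNorm_sum_le _ _).trans ((Finset.sum_le_sum fun x _ => ?_).trans
    (le_add_of_nonneg_left (traceNorm_nonneg X)))
  refine (traceNorm_smul_le _ _).trans (mul_le_mul_of_nonneg_left ?_ (norm_nonneg _))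
  exact traceNorm_mul_mul_le (norm_single_kronecker_one_le k _ _)
    (norm_single_kronecker_one_le k _ _) X

theorem exists_diamondNorm_le (Φ : Matrix m m ℂ →ₗ[ℂ] Matrix m m ℂ) :
    ∃ K : ℝ, 0 < K ∧ diamondNorm Φ ≤ ENNReal.ofReal K := by
  obtain ⟨K, hK, h⟩ := exists_traceNorm_ampliate_le Φ
  refine ⟨K, hK, iSup_le fun k => iSup_le fun X => iSup_le fun hX => ENNReal.ofReal_le_ofReal ?_⟩
  exact (h k X).trans (mul_le_of_le_one_right hK.le hX)

theorem diamondNorm_smul (c : ℂ) (Φ : Matrix m m ℂ →ₗ[ℂ] Matrix m m ℂ) :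
    diamondNorm (c • Φ) = ENNReal.ofReal ‖c‖ * diamondNorm Φ := by
  simp only [diamondNorm, ampliate_smul, traceNorm_smul, ENNReal.mul_iSup,
    ENNReal.ofReal_mul (norm_nonneg c)]

theorem exists_le_diamondNorm {Φ : Matrix m m ℂ →ₗ[ℂ] Matrix m m ℂ} (hΦ : Φ ≠ 0) :
    ∃ δ : ℝ, 0 < δ ∧ ENNReal.ofReal δ ≤ diamondNorm Φ := by
  obtain ⟨Y, hY⟩ : ∃ Y, Φ Y ≠ 0 := by
    by_contra! h
    exact hΦ (LinearMap.ext h)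
  -- A trivial ancilla of dimension 1 already witnesses a positive norm.
  obtain ⟨X, hX⟩ : ∃ X : Matrix (m × Fin 1) (m × Fin 1) ℂ, X = Y.submatrix Prod.fst Prod.fst :=
    ⟨_, rfl⟩
  have h0 : X ≠ 0 := by
    rintro rfl
    refine hY ?_
    have : Y = 0 := by
      ext i j
      exact (congrFun (congrFun hX (i, 0)) (j, 0)).symm
    rw [this, map_zero]
  have h1 : ampliate 1 Φ X ≠ 0 := by
    intro h
    refine hY ?_
    ext i j
    have := congrFun (congrFun h (i, 0)) (j, 0)
    rw [hX] at this
    exact this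
  have hX1 := traceNorm_pos h0
  have hc : ‖((traceNorm X)⁻¹ : ℂ)‖ = (traceNorm X)⁻¹ := by
    rw [norm_inv, Complex.norm_real, Real.norm_of_nonneg hX1.le]
  have h2 : ampliate 1 Φ (((traceNorm X)⁻¹ : ℂ) • X) =
      ((traceNorm X)⁻¹ : ℂ) • ampliate 1 Φ X := by
    ext a b
    exact congrFun (congrFun (map_smul Φ ((traceNorm X)⁻¹ : ℂ) (blockAt X a.2 b.2)) a.1) b.1
  refine ⟨(traceNorm X)⁻¹ * traceNorm (ampliate 1 Φ X),
    mul_pos (inv_pos.mpr hX1) (traceNorm_pos h1), ?_⟩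
  refine le_iSup_of_le 1 (le_iSup_of_le (((traceNorm X)⁻¹ : ℂ) • X) (le_iSup_of_le ?_ ?_))
  · rw [traceNorm_smul, hc, inv_mul_cancel₀ hX1.ne']
  · rw [h2, traceNorm_smul, hc]

end DiamondNorm


/-! ### Domination by the Haar moment and complete positivity -/

section Domination

variable {n : Type} [Fintype n] [DecidableEq n]

/-- A linear combination of the entries of `U ^ ⊗ t`. -/
def entrySum (t : ℕ) (c : Matrix (Fin t → n) (Fin t → n) ℂ) (U : unitaryGroup n ℂ) : ℂ :=
  ∑ x, ∑ y, c x y * tensorPow t U.1 x y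

theorem continuous_tensorPow_apply (t : ℕ) (x y : Fin t → n) :
    Continuous fun U : unitaryGroup n ℂ => tensorPow t U.1 x y := by
  have hv : Continuous fun U : unitaryGroup n ℂ => U.1 := continuous_subtype_val
  simp only [tensorPow, Matrix.of_apply]
  exact continuous_finsetProd _ fun k _ => hv.matrix_elem (x k) (y k)

theorem continuous_entrySum (t : ℕ) (c : Matrix (Fin t → n) (Fin t → n) ℂ) :
    Continuous (entrySum t c) :=
  continuous_finsetSum _ fun x _ => continuous_finsetSum _ fun y _ =>
    continuous_const.mul (continuous_tensorPow_apply t x y)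

theorem integrable_of_continuous {E : Type} [NormedAddCommGroup E]
    (ν : Measure (unitaryGroup n ℂ)) [IsProbabilityMeasure ν]
    {f : unitaryGroup n ℂ → E} (hf : Continuous f) : Integrable f ν :=
  hf.integrable_of_hasCompactSupport (HasCompactSupport.of_compactSpace _)

/-- The supremum of a linear combination of the entries of `U ^ ⊗ t` is bounded by its
mean square. -/
theorem exists_norm_entrySum_le (n : Type) [Fintype n] [DecidableEq n] (t : ℕ) :
    ∃ K : ℝ, 0 < K ∧ ∀ (c : Matrix (Fin t → n) (Fin t → n) ℂ) (U : unitaryGroup n ℂ),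
      ‖entrySum t c U‖ ^ 2 ≤ K * ∫ V, ‖entrySum t c V‖ ^ 2 ∂(haarUnitary n) := by
  obtain ⟨H, hH⟩ : ∃ H : Submodule ℂ C(unitaryGroup n ℂ, ℂ), H = Submodule.span ℂ (Set.range
    fun p : (Fin t → n) × (Fin t → n) =>
      (⟨_, continuous_tensorPow_apply t p.1 p.2⟩ : C(unitaryGroup n ℂ, ℂ))) := ⟨_, rfl⟩
  have : FiniteDimensional ℂ H := by
    rw [hH]
    exact FiniteDimensional.span_of_finite ℂ (Set.finite_range _)
  obtain ⟨L, hL⟩ : ∃ L : C(unitaryGroup n ℂ, ℂ) →L[ℂ] Lp ℂ 2 (haarUnitary n),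
    L = ContinuousMap.toLp 2 (haarUnitary n) ℂ := ⟨_, rfl⟩
  -- Haar measure charges every nonempty open set, so continuous functions embed in L². On the
  -- finite-dimensional `H` an injective map is bounded below.
  have hinj : LinearMap.ker (L.toLinearMap ∘ₗ H.subtype) = ⊥ := by
    rw [LinearMap.ker_eq_bot, hL]
    exact (ContinuousMap.toLp_injective (haarUnitary n)).comp Subtype.val_injective
  obtain ⟨K, hK0, hK⟩ := LinearMap.exists_antilipschitzWith _ hinj
  refine ⟨(K : ℝ) ^ 2, by positivity, fun c U => ?_⟩
  obtain ⟨f, hf⟩ : ∃ f : C(unitaryGroup n ℂ, ℂ), f = ⟨_, continuous_entrySum t c⟩ := ⟨_, rfl⟩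
  have hfH : f ∈ H := by
    have : f = ∑ x, ∑ y, c x y •
        (⟨_, continuous_tensorPow_apply t x y⟩ : C(unitaryGroup n ℂ, ℂ)) := by
      ext V
      rw [hf]
      simp [entrySum, ContinuousMap.sum_apply]
    rw [this, hH]
    exact sum_mem fun x _ => sum_mem fun y _ => Submodule.smul_mem _ _
      (Submodule.subset_span ⟨(x, y), rfl⟩)
  have h1 : ‖f‖ ≤ K * ‖L f‖ := by
    have := hK.le_mul_dist (⟨f, hfH⟩ : H) 0
    rw [map_zero, dist_zero_right, dist_zero_right] at this
    exact this
  have h2 : ‖L f‖ ^ 2 = ∫ V, ‖entrySum t c V‖ ^ 2 ∂(haarUnitary n) := by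
    have h3 := @inner_self_eq_norm_sq_to_K ℂ _ _ _ _ (L f)
    rw [hL, ContinuousMap.inner_toLp] at h3
    have h4 : ∀ V, f V * (starRingEnd ℂ) (f V) = ((‖entrySum t c V‖ ^ 2 : ℝ) : ℂ) := by
      intro V
      rw [Complex.mul_conj', hf]
      push_cast
      rfl
    simp only [h4] at h3
    rw [integral_complex_ofReal] at h3
    rw [hL]
    exact (Complex.ofReal_injective (h3.trans (by push_cast; rfl))).symm
  have h3 : ‖entrySum t c U‖ ≤ ‖f‖ := by
    have := f.norm_coe_le_norm U
    rwa [hf] at this ⊢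
  calc ‖entrySum t c U‖ ^ 2 ≤ (K * ‖L f‖) ^ 2 := by
        gcongr
        exact h3.trans h1
    _ = _ := by rw [mul_pow, h2]

theorem momentOp_conjTranspose (t : ℕ) (ν : Measure (unitaryGroup n ℂ)) [IsProbabilityMeasure ν]
    (X : Matrix (Fin t → n) (Fin t → n) ℂ) : momentOp t ν Xᴴ = (momentOp t ν X)ᴴ := by
  ext x y
  change ∫ U : unitaryGroup n ℂ, (tensorPow t U.1 * Xᴴ * (tensorPow t U.1)ᴴ) x y ∂ν =
    (starRingEnd ℂ) (∫ U : unitaryGroup n ℂ, (tensorPow t U.1 * X * (tensorPow t U.1)ᴴ) y x ∂ν)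
  rw [← integral_conj]
  refine integral_congr_ae (Filter.Eventually.of_forall fun U => ?_)
  have h : tensorPow t U.1 * Xᴴ * (tensorPow t U.1)ᴴ =
      (tensorPow t U.1 * X * (tensorPow t U.1)ᴴ)ᴴ := by
    simp only [conjTranspose_mul, conjTranspose_conjTranspose, Matrix.mul_assoc]
  simp only [h]
  rfl

theorem isHermitian_ampliate {m : Type} {k : ℕ} {Φ : Matrix m m ℂ →ₗ[ℂ] Matrix m m ℂ}
    (hΦ : ∀ X, Φ Xᴴ = (Φ X)ᴴ) {X : Matrix (m × Fin k) (m × Fin k) ℂ} (hX : X.IsHermitian) :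
    (ampliate k Φ X).IsHermitian := by
  ext a b
  change ((Φ (blockAt X b.2 a.2))ᴴ) a.1 b.1 = Φ (blockAt X a.2 b.2) a.1 b.1
  have h : (blockAt X b.2 a.2)ᴴ = blockAt X a.2 b.2 := by
    ext i j
    exact hX.apply _ _
  rw [← hΦ, h]

theorem dotProduct_mulVec_eq_sum {l : Type} [Fintype l] (M : Matrix l l ℂ) (w : l → ℂ) :
    star w ⬝ᵥ (M *ᵥ w) = ∑ a, ∑ b, M a b * (star (w a) * w b) := by
  simp only [dotProduct, mulVec, Finset.mul_sum, Pi.star_apply]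
  exact Finset.sum_congr rfl fun a _ => Finset.sum_congr rfl fun b _ => by ring

theorem dotProduct_ampliate_momentOp (t : ℕ) (ν : Measure (unitaryGroup n ℂ))
    [IsProbabilityMeasure ν] (k : ℕ)
    (X : Matrix ((Fin t → n) × Fin k) ((Fin t → n) × Fin k) ℂ) (w : (Fin t → n) × Fin k → ℂ) :
    star w ⬝ᵥ (ampliate k (momentOp t ν) X *ᵥ w) =
      ∫ U : unitaryGroup n ℂ, star w ⬝ᵥ (((tensorPow t U.1 ⊗ₖ (1 : Matrix (Fin k) (Fin k) ℂ)) * X *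
        ((tensorPow t U.1)ᴴ ⊗ₖ (1 : Matrix (Fin k) (Fin k) ℂ))) *ᵥ w) ∂ν := by
  simp only [dotProduct_mulVec_eq_sum, kronecker_one_conj_apply]
  rw [integral_finsetSum _ fun x _ => integrable_finsetSum _ fun y _ =>
    (integrable_twirl t ν _ _ _).mul_const _]
  refine Finset.sum_congr rfl fun x _ => ?_
  rw [integral_finsetSum _ fun y _ => (integrable_twirl t ν _ _ _).mul_const _]
  refine Finset.sum_congr rfl fun y _ => ?_
  rw [integral_mul_const]
  rfl

/-- With T the ampliated U^⊗t, the left side is ‖B T† w‖², and the conjugates of the coordinates of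
that vector are linear in the entries of U^⊗t. -/
theorem dotProduct_conj_eq_sum_entrySum (t k : ℕ)
    (B : Matrix ((Fin t → n) × Fin k) ((Fin t → n) × Fin k) ℂ) (w : (Fin t → n) × Fin k → ℂ)
    (U : unitaryGroup n ℂ) :
    star w ⬝ᵥ (((tensorPow t U.1 ⊗ₖ (1 : Matrix (Fin k) (Fin k) ℂ)) * (Bᴴ * B) *
        ((tensorPow t U.1)ᴴ ⊗ₖ (1 : Matrix (Fin k) (Fin k) ℂ))) *ᵥ w) =
      ((∑ j, ‖entrySum t (Matrix.of fun x y => ∑ s, star (w (x, s)) * star (B j (y, s))) U‖ ^ 2 :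
        ℝ) : ℂ) := by
  obtain ⟨T, hT⟩ : ∃ T, T = tensorPow t U.1 ⊗ₖ (1 : Matrix (Fin k) (Fin k) ℂ) := ⟨_, rfl⟩
  have hT' : (tensorPow t U.1)ᴴ ⊗ₖ (1 : Matrix (Fin k) (Fin k) ℂ) = Tᴴ := by
    rw [hT, conjTranspose_kronecker, conjTranspose_one]
  have h1 : T * (Bᴴ * B) * Tᴴ = (B * Tᴴ)ᴴ * (B * Tᴴ) := by
    simp only [conjTranspose_mul, conjTranspose_conjTranspose, Matrix.mul_assoc]
  rw [hT', ← hT, h1, ← mulVec_mulVec, dotProduct_mulVec, vecMul_conjTranspose, star_star]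
  rw [dotProduct, Complex.ofReal_sum]
  refine Finset.sum_congr rfl fun j _ => ?_
  have h2 : entrySum t (Matrix.of fun x y => ∑ s, star (w (x, s)) * star (B j (y, s))) U =
      star (((B * Tᴴ) *ᵥ w) j) := by
    rw [← mulVec_mulVec]
    simp only [entrySum, of_apply, mulVec, dotProduct, star_sum, star_mul', conjTranspose_apply,
      star_star, hT, kroneckerMap_apply, Matrix.one_apply, Fintype.sum_prod_type, Finset.sum_mul,
      Finset.mul_sum, mul_ite, ite_mul, mul_zero, zero_mul, mul_one]
    simp
    rw [Finset.sum_comm]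
    refine Finset.sum_congr rfl fun y _ => ?_
    rw [Finset.sum_comm]
    refine Finset.sum_congr rfl fun s _ => Finset.sum_congr rfl fun x _ => ?_
    ring
  rw [h2, norm_star, Pi.star_apply, Complex.star_def, Complex.conj_mul']
  push_cast
  rfl

open scoped MatrixOrder Matrix.Norms.L2Operator in
theorem exists_eq_conjTranspose_mul_self {l : Type} [Fintype l] [DecidableEq l]
    {X : Matrix l l ℂ} (hX : X.PosSemidef) : ∃ B : Matrix l l ℂ, X = Bᴴ * B :=
  CStarAlgebra.nonneg_iff_eq_star_mul_self.mp hX.nonneg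

/-- Every moment operator is dominated by a multiple of the Haar moment. -/
theorem exists_dotProduct_ampliate_le (n : Type) [Fintype n] [DecidableEq n] (t : ℕ) :
    ∃ K : ℝ, 0 < K ∧ ∀ (ν : Measure (unitaryGroup n ℂ)) [IsProbabilityMeasure ν] (k : ℕ)
      (X : Matrix ((Fin t → n) × Fin k) ((Fin t → n) × Fin k) ℂ), X.PosSemidef →
      ∀ w : (Fin t → n) × Fin k → ℂ, ∃ a b : ℝ, 0 ≤ a ∧ 0 ≤ b ∧ a ≤ K * b ∧
        star w ⬝ᵥ (ampliate k (momentOp t ν) X *ᵥ w) = a ∧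
        star w ⬝ᵥ (ampliate k (momentOp t (haarUnitary n)) X *ᵥ w) = b := by
  obtain ⟨K, hK, h⟩ := exists_norm_entrySum_le n t
  refine ⟨K, hK, fun ν _ k X hX w => ?_⟩
  obtain ⟨B, rfl⟩ := exists_eq_conjTranspose_mul_self hX
  obtain ⟨c, hc⟩ : ∃ c : (Fin t → n) × Fin k → Matrix (Fin t → n) (Fin t → n) ℂ,
    c = fun j => Matrix.of fun x y => ∑ s, star (w (x, s)) * star (B j (y, s)) := ⟨_, rfl⟩
  have hquad : ∀ (μ : Measure (unitaryGroup n ℂ)) [IsProbabilityMeasure μ],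
      star w ⬝ᵥ (ampliate k (momentOp t μ) (Bᴴ * B) *ᵥ w) =
        ((∫ U, ∑ j, ‖entrySum t (c j) U‖ ^ 2 ∂μ : ℝ) : ℂ) := by
    intro μ _
    rw [dotProduct_ampliate_momentOp]
    simp only [dotProduct_conj_eq_sum_entrySum]
    rw [integral_complex_ofReal, hc]
  have hcont : ∀ j, Continuous fun U => ‖entrySum t (c j) U‖ ^ 2 := fun j =>
    (continuous_entrySum t (c j)).norm.pow 2
  refine ⟨_, _, integral_nonneg fun U => ?_, integral_nonneg fun U => ?_, ?_, hquad ν,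
    hquad (haarUnitary n)⟩
  · exact Finset.sum_nonneg fun j _ => sq_nonneg _
  · exact Finset.sum_nonneg fun j _ => sq_nonneg _
  · have hle : ∀ U, ∑ j, ‖entrySum t (c j) U‖ ^ 2 ≤
        K * ∫ V, ∑ j, ‖entrySum t (c j) V‖ ^ 2 ∂(haarUnitary n) := by
      intro U
      rw [integral_finsetSum _ fun j _ => integrable_of_continuous _ (hcont j), Finset.mul_sum]
      exact Finset.sum_le_sum fun j _ => h (c j) U
    refine (integral_mono (integrable_of_continuous _ (continuous_finsetSum _ fun j _ => hcont j))
      (integrable_const _) hle).trans ?_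
    simp

theorem isCompletelyPositive_smul {m : Type} [Fintype m] [DecidableEq m]
    {Φ : Matrix m m ℂ →ₗ[ℂ] Matrix m m ℂ} (hΦ : IsCompletelyPositive Φ) {r : ℝ} (hr : 0 ≤ r) :
    IsCompletelyPositive ((r : ℂ) • Φ) := by
  intro k X hX
  rw [ampliate_smul]
  exact (hΦ k X hX).smul (by exact_mod_cast hr)

theorem momentOp_comb_conjTranspose (t : ℕ) (μ ν : Measure (unitaryGroup n ℂ))
    [IsProbabilityMeasure μ] [IsProbabilityMeasure ν] (r s : ℝ)
    (X : Matrix (Fin t → n) (Fin t → n) ℂ) :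
    ((r : ℂ) • momentOp t μ + (s : ℂ) • (momentOp t ν - momentOp t μ)) Xᴴ =
      (((r : ℂ) • momentOp t μ + (s : ℂ) • (momentOp t ν - momentOp t μ)) X)ᴴ := by
  simp only [LinearMap.add_apply, LinearMap.smul_apply, LinearMap.sub_apply,
    momentOp_conjTranspose, conjTranspose_add, conjTranspose_smul, conjTranspose_sub]
  simp

theorem dotProduct_ampliate_comb {m : Type} [Fintype m] [DecidableEq m] (k : ℕ)
    (Φ Ψ : Matrix m m ℂ →ₗ[ℂ] Matrix m m ℂ) (r s : ℂ) (X : Matrix (m × Fin k) (m × Fin k) ℂ)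
    (w : m × Fin k → ℂ) :
    star w ⬝ᵥ (ampliate k (r • Φ + s • (Ψ - Φ)) X *ᵥ w) =
      r * (star w ⬝ᵥ (ampliate k Φ X *ᵥ w)) + s * (star w ⬝ᵥ (ampliate k Ψ X *ᵥ w) -
        star w ⬝ᵥ (ampliate k Φ X *ᵥ w)) := by
  have h : ampliate k (r • Φ + s • (Ψ - Φ)) X =
      r • ampliate k Φ X + s • (ampliate k Ψ X - ampliate k Φ X) := rfl
  rw [h, add_mulVec, smul_mulVec, smul_mulVec, sub_mulVec, dotProduct_add, dotProduct_smul,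
    dotProduct_smul, dotProduct_sub, smul_eq_mul, smul_eq_mul]

/-- If a and b are the quadratic forms of the two moments, with 0 ≤ a ≤ K b, then (K + 1) b ± (a -
b) ≥ 0. -/
theorem exists_isCompletelyPositive (t : ℕ) (ν : Measure (unitaryGroup n ℂ))
    [IsProbabilityMeasure ν] :
    ∃ K : ℝ, 0 < K ∧
      IsCompletelyPositive ((K : ℂ) • momentOp t (haarUnitary n) +
        (momentOp t ν - momentOp t (haarUnitary n))) ∧
      IsCompletelyPositive ((K : ℂ) • momentOp t (haarUnitary n) -
        (momentOp t ν - momentOp t (haarUnitary n))) := by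
  obtain ⟨K, hK, h⟩ := exists_dotProduct_ampliate_le n t
  have key : ∀ s : ℝ, (s = 1 ∨ s = -1) →
      IsCompletelyPositive (((K + 1 : ℝ) : ℂ) • momentOp t (haarUnitary n) +
        (s : ℂ) • (momentOp t ν - momentOp t (haarUnitary n))) := by
    intro s hs k X hX
    refine PosSemidef.of_dotProduct_mulVec_nonneg
      (isHermitian_ampliate (momentOp_comb_conjTranspose t _ _ _ _) hX.isHermitian) fun w => ?_
    obtain ⟨a, b, ha, hb, hab, h1, h2⟩ := h ν k X hX w
    rw [dotProduct_ampliate_comb, h1, h2]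
    have h3 : 0 ≤ (K + 1) * b + s * (a - b) := by
      rcases hs with rfl | rfl <;> nlinarith
    exact_mod_cast h3
  refine ⟨K + 1, by positivity, ?_, ?_⟩
  · have := key 1 (Or.inl rfl)
    rwa [Complex.ofReal_one, one_smul] at this
  · have := key (-1) (Or.inr rfl)
    have e : ∀ Φ : Matrix (Fin t → n) (Fin t → n) ℂ →ₗ[ℂ] Matrix (Fin t → n) (Fin t → n) ℂ,
        ((-1 : ℝ) : ℂ) • Φ = -Φ := fun Φ => by
      ext1 X
      simp
    rwa [e, ← sub_eq_add_neg] at this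

/-- A nonzero linear map does not vanish on all rank-one projections. -/
theorem exists_vecMulVec_ne_zero {m : Type} [Fintype m] [DecidableEq m]
    {Φ : Matrix m m ℂ →ₗ[ℂ] Matrix m m ℂ} (hΦ : Φ ≠ 0) :
    ∃ v : m → ℂ, Φ (vecMulVec v (star v)) ≠ 0 := by
  by_contra! h
  refine hΦ (LinearMap.ext fun X => ?_)
  have hs : ∀ i j, Φ (single i j 1) = 0 := by
    intro i j
    have hst : ∀ i, star (Pi.single i 1 : m → ℂ) = Pi.single i 1 := by
      intro i
      ext k
      by_cases hk : k = i
      · subst hk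
        simp
      · simp [hk]
    have e : ∀ (c : ℂ), vecMulVec (Pi.single i 1 + c • Pi.single j 1 : m → ℂ)
        (star (Pi.single i 1 + c • Pi.single j 1)) = single i i 1 + star c • single i j 1 +
          (c • single j i 1 + (c * star c) • single j j 1) := by
      intro c
      simp only [star_add, star_smul, vecMulVec_add, add_vecMulVec, smul_vecMulVec,
        vecMulVec_smul, single_eq_single_vecMulVec_single, hst]
      module
    have h0 : ∀ i, Φ (single i i 1) = 0 := by
      intro i
      have := h (Pi.single i 1)
      rwa [hst, ← single_eq_single_vecMulVec_single] at this
    -- Polarisation: the phases 1 and i separate the matrix unit from its transpose.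
    have h1 := h (Pi.single i 1 + (1 : ℂ) • Pi.single j 1)
    have h2 := h (Pi.single i 1 + Complex.I • Pi.single j 1)
    rw [e] at h1 h2
    simp only [map_add, map_smul, h0, smul_zero, add_zero, zero_add, star_one, one_smul,
      Complex.star_def, Complex.conj_I] at h1 h2
    have h3 : (2 * Complex.I) • Φ (single i j 1) = 0 := by
      have : (2 * Complex.I) • Φ (single i j 1) =
        Complex.I • (Φ (single i j 1) + Φ (single j i 1)) -
          (-Complex.I • Φ (single i j 1) + Complex.I • Φ (single j i 1)) := by module
      rw [this, h1, h2, smul_zero, sub_zero]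
    exact (smul_eq_zero.mp h3).resolve_left (by simp)
  rw [matrix_eq_sum_single X, LinearMap.zero_apply]
  simp only [map_sum]
  refine Finset.sum_eq_zero fun i _ => Finset.sum_eq_zero fun j _ => ?_
  have : single i j (X i j) = X i j • single i j (1 : ℂ) := by
    rw [smul_single, smul_eq_mul, mul_one]
  rw [this, map_smul, hs, smul_zero]

theorem IsCompletelyPositive.posSemidef {m : Type} [Fintype m] [DecidableEq m]
    {Φ : Matrix m m ℂ →ₗ[ℂ] Matrix m m ℂ} (hΦ : IsCompletelyPositive Φ) {X : Matrix m m ℂ}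
    (hX : X.PosSemidef) : (Φ X).PosSemidef :=
  (hΦ 1 _ (hX.submatrix Prod.fst)).submatrix fun i => (i, 0)

/-- A moment operator that differs from the Haar moment is not a multiplicative-error design for
small errors. -/
theorem exists_not_isCompletelyPositive (t : ℕ) (ν : Measure (unitaryGroup n ℂ))
    [IsProbabilityMeasure ν] (hν : momentOp t ν - momentOp t (haarUnitary n) ≠ 0)
    {κ : ℕ → ℝ} (hκ : Filter.Tendsto κ Filter.atTop (nhds 0)) :
    ∃ d, ¬ IsCompletelyPositive ((κ d : ℂ) • momentOp t (haarUnitary n) +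
      (momentOp t ν - momentOp t (haarUnitary n))) := by
  by_contra! h
  obtain ⟨v, hv⟩ := exists_vecMulVec_ne_zero hν
  refine hv ?_
  obtain ⟨X, hX⟩ : ∃ X, X = vecMulVec v (star v) := ⟨_, rfl⟩
  have hX0 : X.PosSemidef := hX ▸ posSemidef_vecMulVec_self_star v
  rw [← hX]
  have hherm : ((momentOp t ν - momentOp t (haarUnitary n)) X).IsHermitian := by
    change ((momentOp t ν - momentOp t (haarUnitary n)) X)ᴴ = _
    rw [LinearMap.sub_apply, conjTranspose_sub, ← momentOp_conjTranspose,
      ← momentOp_conjTranspose, hX0.isHermitian.eq]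
  have hpsd : ((momentOp t ν - momentOp t (haarUnitary n)) X).PosSemidef := by
    refine PosSemidef.of_dotProduct_mulVec_nonneg hherm fun w => ?_
    have hd : ∀ d, 0 ≤ (κ d : ℂ) * (star w ⬝ᵥ (momentOp t (haarUnitary n) X *ᵥ w)) +
        star w ⬝ᵥ ((momentOp t ν - momentOp t (haarUnitary n)) X *ᵥ w) := by
      intro d
      have := ((h d).posSemidef hX0).dotProduct_mulVec_nonneg w
      rwa [LinearMap.add_apply, LinearMap.smul_apply, add_mulVec, dotProduct_add, smul_mulVec,
        dotProduct_smul, smul_eq_mul] at this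
    have hlim : Filter.Tendsto (fun d => (κ d : ℂ) *
        (star w ⬝ᵥ (momentOp t (haarUnitary n) X *ᵥ w)) +
        star w ⬝ᵥ ((momentOp t ν - momentOp t (haarUnitary n)) X *ᵥ w)) Filter.atTop
        (nhds (star w ⬝ᵥ ((momentOp t ν - momentOp t (haarUnitary n)) X *ᵥ w))) := by
      have h1 : Filter.Tendsto (fun d => (κ d : ℂ)) Filter.atTop (nhds 0) := by
        have := (Complex.continuous_ofReal.tendsto 0).comp hκ
        rwa [Complex.ofReal_zero] at this
      have h2 := (h1.mul_const (star w ⬝ᵥ (momentOp t (haarUnitary n) X *ᵥ w))).add_const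
        (star w ⬝ᵥ ((momentOp t ν - momentOp t (haarUnitary n)) X *ᵥ w))
      rwa [zero_mul, zero_add] at h2
    have := Complex.orderClosedTopology
    exact ge_of_tendsto' hlim hd
  -- Both moments preserve the trace, so the limit is positive semidefinite of trace zero.
  refine hpsd.trace_eq_zero_iff.mp ?_
  rw [LinearMap.sub_apply, trace_sub, trace_momentOp, trace_momentOp, sub_self]

end Domination


/-! ### Separation of the two periods in both notions -/

section Designs

variable {M : ℕ}

theorem periodC_sub_haar_ne (hM : 3 ≤ M) :
    momentOp 2 (circuitLaw (periodC (M + 2))) - momentOp 2 (haarUnitary (Qubits (M + 2))) ≠ 0 := by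
  intro h
  refine periodC_sub_haar_partSwap_ne hM ?_
  rw [h, LinearMap.zero_apply]

theorem exists_additive_separation (hM : 3 ≤ M) : ∃ (ε : ℝ) (d : ℕ), 0 < ε ∧
    IsAdditiveApproxDesign 2 ε (circuitLaw ((periodC' (M + 2)).repeated d)) ∧
    ¬ IsAdditiveApproxDesign 2 ε (circuitLaw ((periodC (M + 2)).repeated d)) := by
  obtain ⟨K, hK, hKle⟩ := exists_diamondNorm_le
    (momentOp 2 (circuitLaw (periodC' (M + 2))) - momentOp 2 (haarUnitary (Qubits (M + 2))))
  obtain ⟨δ, hδ, hδle⟩ := exists_le_diamondNorm (periodC_sub_haar_ne hM)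
  have h' := rateC'_pos (M := M)
  have hlt := rateC'_lt_rateC hM
  have h0 := h'.trans hlt
  -- Such a `d` makes the upper bound r'^d K for C' smaller than the lower bound r^d δ for C.
  obtain ⟨d, hd⟩ := exists_pow_lt_of_lt_one (div_pos hδ hK) ((div_lt_one h0).mpr hlt)
  refine ⟨rateC' M ^ d * K, d + 1, by positivity, ?_, ?_⟩
  · rw [IsAdditiveApproxDesign, periodC'_repeated_sub_haar, diamondNorm_smul, Complex.norm_real,
      Real.norm_of_nonneg (by positivity), ENNReal.ofReal_mul (by positivity)]
    gcongr
  · rw [IsAdditiveApproxDesign, periodC_repeated_sub_haar, diamondNorm_smul, Complex.norm_real,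
      Real.norm_of_nonneg (by positivity), not_le]
    have h1 : rateC' M ^ d * K < rateC M ^ d * δ := by
      rw [div_pow, div_lt_div_iff₀ (by positivity) hK] at hd
      linarith
    refine ((ENNReal.ofReal_lt_ofReal_iff (by positivity)).mpr h1).trans_le ?_
    rw [ENNReal.ofReal_mul (by positivity)]
    gcongr

theorem exists_multiplicative_separation (hM : 3 ≤ M) : ∃ (ε : ℝ) (d : ℕ), 0 < ε ∧
    IsMultiplicativeApproxDesign 2 ε (circuitLaw ((periodC' (M + 2)).repeated d)) ∧
    ¬ IsMultiplicativeApproxDesign 2 ε (circuitLaw ((periodC (M + 2)).repeated d)) := by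
  obtain ⟨K, hK, hKp, hKm⟩ := exists_isCompletelyPositive 2 (circuitLaw (periodC' (M + 2)))
  have h' := rateC'_pos (M := M)
  have hlt := rateC'_lt_rateC hM
  have h0 := h'.trans hlt
  have hκ : Filter.Tendsto (fun d : ℕ => K * (rateC' M / rateC M) ^ d) Filter.atTop (nhds 0) := by
    have := (tendsto_pow_atTop_nhds_zero_of_lt_one (by positivity)
      ((div_lt_one h0).mpr hlt)).const_mul K
    rwa [mul_zero] at this
  obtain ⟨d, hd⟩ := exists_not_isCompletelyPositive 2 (circuitLaw (periodC (M + 2)))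
    (periodC_sub_haar_ne hM) hκ
  refine ⟨rateC' M ^ d * K, d + 1, by positivity, ⟨?_, ?_⟩, fun h => hd ?_⟩
  · rw [periodC'_repeated_sub_haar, Complex.ofReal_mul, mul_smul, ← smul_add]
    exact isCompletelyPositive_smul hKp (by positivity)
  · rw [periodC'_repeated_sub_haar, Complex.ofReal_mul, mul_smul]
    have hsub : ∀ (c : ℂ) (Φ Ψ : Matrix (Fin 2 → Qubits (M + 2)) (Fin 2 → Qubits (M + 2)) ℂ →ₗ[ℂ]
        Matrix (Fin 2 → Qubits (M + 2)) (Fin 2 → Qubits (M + 2)) ℂ),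
        c • Φ - c • Ψ = c • (Φ - Ψ) :=
      fun c Φ Ψ => LinearMap.ext fun X => (smul_sub c (Φ X) (Ψ X)).symm
    rw [hsub]
    exact isCompletelyPositive_smul hKm (by positivity)
  -- Dividing the design condition for C by r^d turns ε into K (r'/r)^d, the null sequence chosen
  -- above.
  · have h1 := h.1
    rw [periodC_repeated_sub_haar] at h1
    have h2 := isCompletelyPositive_smul h1 (r := (rateC M ^ d)⁻¹) (by positivity)
    rw [smul_add, smul_smul, smul_smul, ← Complex.ofReal_mul, ← Complex.ofReal_mul,
      inv_mul_cancel₀ (by positivity), Complex.ofReal_one, one_smul] at h2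
    have h3 : (rateC M ^ d)⁻¹ * (rateC' M ^ d * K) = K * (rateC' M / rateC M) ^ d := by
      rw [div_pow]
      ring
    rwa [h3] at h2

end Designs

end RandomCircuit

theorem theorem1 :
    ∃ N₀ : ℕ, ∀ N : ℕ, N₀ ≤ N →
      (∃ (ε : ℝ) (d : ℕ), 0 < ε ∧
        IsAdditiveApproxDesign 2 ε (circuitLaw ((periodC' N).repeated d)) ∧
        ¬ IsAdditiveApproxDesign 2 ε (circuitLaw ((periodC N).repeated d))) ∧
      (∃ (ε : ℝ) (d : ℕ), 0 < ε ∧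
        IsMultiplicativeApproxDesign 2 ε (circuitLaw ((periodC' N).repeated d)) ∧
        ¬ IsMultiplicativeApproxDesign 2 ε (circuitLaw ((periodC N).repeated d))) := by
  -- M = N - 2 must be at least 3 for the comparison of rates.
  refine ⟨5, fun N hN => ?_⟩
  obtain ⟨M, rfl⟩ : ∃ M, N = M + 2 := ⟨N - 2, by omega⟩
  exact ⟨exists_additive_separation (by omega), exists_multiplicative_separation (by omega)⟩
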